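/- Let $q\ge 1$ and $\vec n=(n_1,\dots,n_q)$ with integers $n_i\ge 2$, and put $|\vec n|=\prod_{i=1}^q n_i$. The periodic $q$-cubical lattice $Y$ with side lengths $\vec n$ consists of the elementary cubes $I_1\times\cdots\times I_q$ of the torus $\prod_{i=1}^q\mathbb R/n_i\mathbb Z$, where each $I_i$ is either a unit interval $[v,v+1]$ or a degenerate interval $[v,v]$ with $v\in\mathbb Z/n_i\mathbb Z$; a $k$-cube is such a product with exactly $k$ nondegenerate factors, and $Y^{(d)}$ is the set of cubes of dimension at most $d$. A closed path of length $m\ge 1$ in $Y^{(d)}$ is a sequence $c=(\tau_0,\sigma_0,\dots,\tau_{m-1},\sigma_{m-1})$ of $(d-1)$-cubes $\tau_i$ and $d$-cubes $\sigma_i$ with $\tau_i\ne\tau_{i+1}$ and $\tau_{i+1}\subset\sigma_i\cap\sigma_{i+1}$ for all $i\in\mathbb Z/m\mathbb Z$. It is a closed geodesic if moreover $\sigma_i\neq\sigma_{i+1}$ for all $i\in\mathbb Z/m\mathbb Z$, and a closed geodesic is prime if it is not an $r$-fold repetition of a closed geodesic with $r\ge2$. A prime cycle $\mathfrak p$ is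 an equivalence class of prime closed geodesics up to cyclic permutation $(\tau_i,\sigma_i)_i\mapsto(\tau_{i+s},\sigma_{i+s})_i$, and $|\mathfrak p|$ is the length of any representative. Let $P_d$ be the set of prime cycles of $Y^{(d)}$ ($P_0=\emptyset$, as there are no $(-1)$-cubes). For $u\in\mathbb C$ with $|u|$ sufficiently small, set $$\zeta_{Y^{(d)}}(u)=\prod_{\mathfrak p\in P_d}\bigl(1-u^{|\mathfrak p|}\bigr)^{-1},\qquad \zeta_Y=\zeta_{Y^{(q)}}.$$ **Theorem.** For all $u\in\mathbb C$ with $|u|$ sufficiently small, the products defining $\zeta_Y(u)$ and $\zeta_{Y^{(q-1)}}(u)$ converge unconditionally to nonzero values, and $$\zeta_Y(u)^{-1}=(1-u^2)^{(q-1)|\vec n|}\prod_{k_1=1}^{n_1}\cdots\prod_{k_q=1}^{n_q}\Bigl\{1-2u\sum_{i=1}^q\cos\frac{2\pi k_i}{n_i}+(2q-1)u^2\Bigr\},$$ $$\zeta_{Y^{(q-1)}}(u)^{-1}=(1-u)^{\kappa|\vec n|}(1+3u)^{\gamma|\vec n|}\prod_{k_1=1}^{n_1}\cdots\prod_{k_q=1}^{n_q}F_1^{\mathrm{up}}(u,\vec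 k),$$ where $\kappa=q(3q-5)/2$, $\gamma=q(q-3)/2$ and, for $\vec k=(k_1,\dots,k_q)$, $$F_1^{\mathrm{up}}(u,\vec k)=\sum_{\ell=0}^q(2-\ell)\,2^{\ell-1}e_\ell(\mathbf w)\Bigl\{1-2u\sum_{i=1}^q\cos\frac{2\pi k_i}{n_i}+3(2q-3)u^2\Bigr\}^{q-\ell}u^\ell,$$ with $e_\ell$ the $\ell$-th elementary symmetric polynomial in $q$ variables and $\mathbf w=\bigl(2+2\cos\frac{2\pi k_i}{n_i}\bigr)_{i=1}^q$. -/

import Mathlib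

namespace PeriodicCubical

/-- An elementary cube `I₁ × ⋯ × I_q` of the periodic cubical lattice with side lengths `n`
(over the complete simplicial complex on `Fin q`).  The `i`-th factor is an interval of the circle
`ℝ / n i ℤ`: the nondegenerate interval `[v, v + 1]` if `i ∈ dir`, and the degenerate interval
`[v, v]` if `i ∉ dir`, where `v = pos i ∈ ℤ / n i ℤ`. -/
@[ext]
structure Cube {q : ℕ} (n : Fin q → ℕ) where
  dir : Finset (Fin q)
  pos : ∀ i, ZMod (n i)

/-- The dimension of a cube: the number of nondegenerate factors. -/
def Cube.dim {q : ℕ} {n : Fin q → ℕ} (σ : Cube n) : ℕ := σ.dir.card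

/-- Containment `τ ⊂ σ` of cubes (equality allowed), factor by factor: `[v, v + 1]` contains the
point intervals at `v` and `v + 1` and, among the unit intervals, only itself; `[v, v]` contains
only itself (side lengths being at least `2`). -/
def Cube.IsSubcube {q : ℕ} {n : Fin q → ℕ} (τ σ : Cube n) : Prop :=
  ∀ i,
    (i ∈ τ.dir ∧ i ∈ σ.dir ∧ τ.pos i = σ.pos i) ∨
    (i ∉ τ.dir ∧ i ∈ σ.dir ∧ (τ.pos i = σ.pos i ∨ τ.pos i = σ.pos i + 1)) ∨
    (i ∉ τ.dir ∧ i ∉ σ.dir ∧ τ.pos i = σ.pos i)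

/-- A closed path `(τ₀, σ₀, τ₁, σ₁, …)` of positive length `len` in the `d`-skeleton: the `τ i` are
`(d-1)`-cubes, the `σ i` are `d`-cubes, `τ i ≠ τ (i+1)` and `τ (i+1) ⊂ σ i ∩ σ (i+1)`, with indices
in `ℤ / len ℤ`.  (For `d = 0` there are no `(d-1)`-cubes, hence no closed paths.) -/
structure ClosedPath {q : ℕ} (n : Fin q → ℕ) (d : ℕ) where
  len : ℕ
  len_pos : 0 < len
  τ : ZMod len → Cube n
  σ : ZMod len → Cube n
  dim_τ : ∀ i, (τ i).dim + 1 = d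
  dim_σ : ∀ i, (σ i).dim = d
  τ_ne : ∀ i, τ i ≠ τ (i + 1)
  sub_left : ∀ i, (τ (i + 1)).IsSubcube (σ i)
  sub_right : ∀ i, (τ (i + 1)).IsSubcube (σ (i + 1))

namespace ClosedPath

variable {q : ℕ} {n : Fin q → ℕ} {d : ℕ}

/-- A closed geodesic is a closed path without back-tracking. -/
def IsGeodesic (c : ClosedPath n d) : Prop := ∀ i, c.σ i ≠ c.σ (i + 1)

/-- `c` is the `m`-multiple of `c'`: it is formed by `m` repetitions of `c'`. -/
def IsMultiple (m : ℕ) (c' c : ClosedPath n d) : Prop :=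
  c.len = m * c'.len ∧
    ∀ k : ℤ, c.τ (k : ZMod c.len) = c'.τ (k : ZMod c'.len) ∧
      c.σ (k : ZMod c.len) = c'.σ (k : ZMod c'.len)

/-- A prime closed geodesic: one that is not an `m`-multiple of a closed geodesic, `m ≥ 2`. -/
def IsPrime (c : ClosedPath n d) : Prop :=
  c.IsGeodesic ∧ ¬ ∃ m : ℕ, 2 ≤ m ∧ ∃ c' : ClosedPath n d, c'.IsGeodesic ∧ IsMultiple m c' c

/-- `c'` is obtained from `c` through a cyclic permutation. -/
def IsCyclicPerm (c c' : ClosedPath n d) : Prop :=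
  c.len = c'.len ∧
    ∃ s : ℤ, ∀ k : ℤ,
      c'.τ (k : ZMod c'.len) = c.τ ((k + s : ℤ) : ZMod c.len) ∧
        c'.σ (k : ZMod c'.len) = c.σ ((k + s : ℤ) : ZMod c.len)

theorem isCyclicPerm_refl (c : ClosedPath n d) : IsCyclicPerm c c :=
  ⟨rfl, 0, fun k => by simp⟩

theorem IsCyclicPerm.symm {c c' : ClosedPath n d} (h : IsCyclicPerm c c') : IsCyclicPerm c' c := by
  obtain ⟨hl, s, hs⟩ := h
  refine ⟨hl.symm, -s, fun k => ?_⟩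
  have := hs (k + -s)
  rw [neg_add_cancel_right] at this
  exact ⟨this.1.symm, this.2.symm⟩

theorem IsCyclicPerm.trans {c c' c'' : ClosedPath n d} (h : IsCyclicPerm c c')
    (h' : IsCyclicPerm c' c'') : IsCyclicPerm c c'' := by
  obtain ⟨hl, s, hs⟩ := h
  obtain ⟨hl', s', hs'⟩ := h'
  refine ⟨hl.trans hl', s' + s, fun k => ?_⟩
  rw [← add_assoc]
  exact ⟨(hs' k).1.trans (hs _).1, (hs' k).2.trans (hs _).2⟩

end ClosedPath

/-- Equivalence of prime closed geodesics up to cyclic permutation. -/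
def primeSetoid {q : ℕ} (n : Fin q → ℕ) (d : ℕ) :
    Setoid {c : ClosedPath n d // c.IsPrime} where
  r c c' := ClosedPath.IsCyclicPerm c.1 c'.1
  iseqv := ⟨fun c => c.1.isCyclicPerm_refl, fun h => h.symm, fun h h' => h.trans h'⟩

/-- The set of prime cycles of the `d`-skeleton. -/
def PrimeCycle {q : ℕ} (n : Fin q → ℕ) (d : ℕ) : Type := Quotient (primeSetoid n d)

/-- The length of a prime cycle. -/
def PrimeCycle.length {q : ℕ} {n : Fin q → ℕ} {d : ℕ} (p : PrimeCycle n d) : ℕ :=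
  Quotient.lift (fun c : {c : ClosedPath n d // c.IsPrime} => c.1.len) (fun c c' (h : ClosedPath.IsCyclicPerm c.1 c'.1) => h.1) p

/-- The Euler factor `(1 - u ^ |𝔭|)⁻¹` of a prime cycle `𝔭` of the `d`-skeleton. -/
noncomputable def eulerFactor {q : ℕ} (n : Fin q → ℕ) (d : ℕ) (u : ℂ) (p : PrimeCycle n d) : ℂ :=
  (1 - u ^ p.length)⁻¹

/-- The Ihara zeta function of the `d`-skeleton (meaningful where the product converges). -/
noncomputable def zeta {q : ℕ} (n : Fin q → ℕ) (d : ℕ) (u : ℂ) : ℂ :=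
  ∏' p : PrimeCycle n d, eulerFactor n d u p

/-- `cos (2 π kᵢ / nᵢ)`, as a complex number. -/
noncomputable def cosAngle {q : ℕ} (n k : Fin q → ℕ) (i : Fin q) : ℂ :=
  ((Real.cos (2 * Real.pi * (k i : ℝ) / (n i : ℝ)) : ℝ) : ℂ)

/-- The index set of all `k = (k₁, …, k_q)` with `1 ≤ kᵢ ≤ nᵢ`. -/
def frequencies {q : ℕ} (n : Fin q → ℕ) : Finset (Fin q → ℕ) :=
  Fintype.piFinset fun i => Finset.Icc 1 (n i)

/-- `κ = q (3 q - 5) / 2`; the division is exact. -/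
def kappa (q : ℕ) : ℤ := (q : ℤ) * (3 * (q : ℤ) - 5) / 2

/-- `γ = q (q - 3) / 2`; the division is exact. -/
def gamma (q : ℕ) : ℤ := (q : ℤ) * ((q : ℤ) - 3) / 2

/-- The polynomial `F₁ᵘᵖ(u, k)`, where `wᵢ = 2 + 2 cos (2 π kᵢ / nᵢ)`. -/
noncomputable def FUp {q : ℕ} (n : Fin q → ℕ) (u : ℂ) (k : Fin q → ℕ) : ℂ :=
  ∑ l ∈ Finset.range (q + 1),
    (2 - (l : ℂ)) * (2 : ℂ) ^ ((l : ℤ) - 1) *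
      MvPolynomial.eval (fun i => 2 + 2 * cosAngle n k i) (MvPolynomial.esymm (Fin q) ℂ l) *
      (1 - 2 * u * (∑ i, cosAngle n k i) + 3 * (2 * (q : ℂ) - 3) * u ^ 2) ^ (q - l) * u ^ l

end PeriodicCubical

/-! A closed geodesic is a closed walk on flags τ ⊂ σ, where each step replaces τ by another face of
σ and then σ by another cube containing the new τ. Unrolled periodically, it becomes a periodic
point of the shift on bi-infinite walks. Prime cycles are exactly the periodic orbits, and their
lengths are the minimal periods (`PrimeCycle.ofWalk_surjective`, `PrimeCycle.ofWalk_eq_iff`). So the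
Euler product is exp(∑ #Fix(shift^m) u^m / m). The number of fixed points is tr T^m for the step
matrix T on flags, hence the product equals 1 / det(1 - uT) near u = 0
(`eventually_hasProd_eulerFactor`).

Each d-cube has 2d facets and each (d-1)-cube lies in 2(q+1-d) d-cubes, so Bass's argument applies
(`det_one_sub_smul_stepMatrix`): up to explicit powers, det(1 - uT) is a determinant in M Mᵀ, with M
the incidence matrix. Since M commutes with translations of the torus, the Fourier transform on ∏
ℤ/n_i splits this determinant into one block per character, indexed by sets of directions
(`det_smul_one_sub_incMatrix`).

For d = q the block is 1 × 1. For d = q-1 it is q × q, diagonal plus rank one, and the matrix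
determinant lemma followed by an expansion in elementary symmetric polynomials produces `FUp`. -/

/-! ### Euler products over periodic orbits. -/

open Function in
/-- **Euler product over periodic orbits.**  If `π` identifies `ι` with the set of periodic orbits
of `f` and `ℓ` is the length of an orbit, the product of `(1 - u ^ ℓ)⁻¹` over the orbits is the
dynamical zeta function `exp (∑ #Fix (f ^ m) u ^ m / m)`. -/
theorem hasProd_periodicOrbits {α ι : Type*} (f : α → α) (π : periodicPts f → ι)
    (hπ : Surjective π) (hπ' : ∀ x y, π x = π y ↔ ∃ k, f^[k] x.1 = y.1) (ℓ : ι → ℕ)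
    (hℓ : ∀ x, ℓ (π x) = minimalPeriod f x.1) (hfin : ∀ m, (ptsOfPeriod f (m + 1)).Finite)
    (u : ℂ) (hu : ‖u‖ < 1)
    (hs : Summable fun m : ℕ => ((ptsOfPeriod f (m + 1)).ncard : ℝ) * ‖u‖ ^ (m + 1)) :
    HasProd (fun p => (1 - u ^ ℓ p)⁻¹)
      (Complex.exp (∑' m : ℕ, ((ptsOfPeriod f (m + 1)).ncard : ℂ) * (u ^ (m + 1) / (m + 1)))) := by
  have hpos : ∀ x : periodicPts f, 0 < minimalPeriod f x.1 := fun x =>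
    minimalPeriod_pos_of_mem_periodicPts x.2
  have hfty : ∀ m, Fintype (ptsOfPeriod f (m + 1)) := fun m => (hfin m).fintype
  let g : (Σ m : ℕ, ptsOfPeriod f (m + 1)) → ℂ := fun p => u ^ (p.1 + 1) / (p.1 + 1)
  have hgs : Summable g := by
    refine Summable.of_norm ?_
    rw [summable_sigma_of_nonneg fun _ => norm_nonneg _]
    refine ⟨fun m => (hasSum_fintype _).summable, ?_⟩
    refine Summable.of_nonneg_of_le (fun m => tsum_nonneg fun _ => norm_nonneg _) (fun m => ?_) hs
    rw [tsum_fintype]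
    simp only [g, Finset.sum_const, nsmul_eq_mul, Finset.card_univ]
    rw [← Nat.card_eq_fintype_card, Nat.card_coe_set_eq]
    refine mul_le_mul_of_nonneg_left ?_ (Nat.cast_nonneg _)
    rw [norm_div, norm_pow]
    refine div_le_self (by positivity) ?_
    have : ((m : ℂ) + 1) = ((m + 1 : ℕ) : ℂ) := by push_cast; ring
    rw [this, Complex.norm_natCast]
    exact_mod_cast Nat.le_add_left 1 m
  have hgsum : HasSum g
      (∑' m : ℕ, ((ptsOfPeriod f (m + 1)).ncard : ℂ) * (u ^ (m + 1) / (m + 1))) := by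
    convert! hgs.hasSum using 1
    rw [hgs.tsum_sigma]
    refine tsum_congr fun m => ?_
    rw [tsum_fintype]
    simp only [g, Finset.sum_const, nsmul_eq_mul, Finset.card_univ]
    rw [← Nat.card_eq_fintype_card, Nat.card_coe_set_eq]
  have hmul : ∀ (x : periodicPts f) (r : ℕ),
      (r + 1) * minimalPeriod f x.1 - 1 + 1 = (r + 1) * minimalPeriod f x.1 := fun x r =>
    Nat.sub_add_cancel (Nat.mul_pos r.succ_pos (hpos x))
  -- A point has period m + 1 exactly when m + 1 is a positive multiple of its minimal period; the
  -- index m records the period minus one.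
  let e : periodicPts f × ℕ → Σ m : ℕ, ptsOfPeriod f (m + 1) := fun p =>
    ⟨(p.2 + 1) * minimalPeriod f p.1.1 - 1, p.1.1, by
      rw [hmul, mem_ptsOfPeriod]
      exact (isPeriodicPt_minimalPeriod f p.1.1).const_mul _⟩
  have he : Bijective e := by
    constructor
    · rintro ⟨x, r⟩ ⟨y, s⟩ h
      have h1 := congrArg (fun q : Σ m : ℕ, ptsOfPeriod f (m + 1) => q.2.1) h
      have h2 := congrArg (fun q : Σ m : ℕ, ptsOfPeriod f (m + 1) => q.1 + 1) h
      have h1' : x = y := Subtype.ext h1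
      subst h1'
      simp only [e, hmul] at h2
      have := Nat.eq_of_mul_eq_mul_right (hpos x) h2
      simpa using this
    · rintro ⟨m, x, hx⟩
      have hx' : x ∈ periodicPts f := mk_mem_periodicPts m.succ_pos hx
      obtain ⟨k, hk⟩ := IsPeriodicPt.minimalPeriod_dvd hx
      have hk0 : k ≠ 0 := by rintro rfl; simp at hk
      obtain ⟨r, rfl⟩ := Nat.exists_eq_succ_of_ne_zero hk0
      refine ⟨(⟨x, hx'⟩, r), ?_⟩
      have h3 : (r + 1) * minimalPeriod f x - 1 = m := by
        rw [mul_comm, ← Nat.succ_eq_add_one, ← hk]; rfl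
      subst h3
      rfl
  have hge : HasSum (g ∘ e)
      (∑' m : ℕ, ((ptsOfPeriod f (m + 1)).ncard : ℂ) * (u ^ (m + 1) / (m + 1))) :=
    (Equiv.hasSum_iff (Equiv.ofBijective e he)).2 hgsum
  have hlt : ∀ l : ℕ, 0 < l → ‖u ^ l‖ < 1 := fun l hl => by
    rw [norm_pow]; exact pow_lt_one₀ (norm_nonneg _) hu hl.ne'
  -- Summing over the multiples of the minimal period ℓ gives the share -log(1 - u^ℓ)/ℓ of one
  -- point; the ℓ points of an orbit together give the logarithm of its Euler factor.
  have hinner : ∀ x : periodicPts f, HasSum (fun r : ℕ => (g ∘ e) (x, r))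
      (-Complex.log (1 - u ^ minimalPeriod f x.1) / minimalPeriod f x.1) := by
    intro x
    have h := (Complex.hasSum_taylorSeries_neg_log' (hlt _ (hpos x))).div_const
      (minimalPeriod f x.1 : ℂ)
    refine h.congr_fun fun r => ?_
    have hc : (((r + 1) * minimalPeriod f x.1 - 1 : ℕ) : ℂ) + 1
        = (r + 1) * minimalPeriod f x.1 := by
      have := congrArg (Nat.cast : ℕ → ℂ) (hmul x r)
      push_cast at this ⊢
      exact this
    simp only [g, e, Function.comp]
    rw [hmul, hc, div_div, ← pow_mul, mul_comm (r + 1)]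
  have houter := hge.prod_fiberwise hinner
  have hfib := (Equiv.hasSum_iff (Equiv.sigmaFiberEquiv π)).2 houter
  have hcard : ∀ p : ι, Nat.card {x // π x = p} = ℓ p := by
    intro p
    obtain ⟨x, rfl⟩ := hπ p
    rw [hℓ]
    let φ : Fin (minimalPeriod f x.1) → {y // π y = π x} := fun k =>
      ⟨⟨f^[k] x.1, mk_mem_periodicPts (hpos x)
        ((isPeriodicPt_minimalPeriod f x.1).apply_iterate k)⟩, ((hπ' _ _).2 ⟨k, rfl⟩).symm⟩
    have hφ : Bijective φ := by
      constructor
      · intro a b hab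
        have : f^[a] x.1 = f^[b] x.1 := congrArg (fun y => y.1.1) hab
        exact Fin.ext (iterate_injOn_Iio_minimalPeriod a.2 b.2 this)
      · rintro ⟨y, hy⟩
        obtain ⟨k, hk⟩ := (hπ' _ _).1 hy.symm
        refine ⟨⟨k % minimalPeriod f x.1, Nat.mod_lt _ (hpos x)⟩, ?_⟩
        refine Subtype.ext (Subtype.ext ?_)
        simpa only [φ, iterate_mod_minimalPeriod_eq] using hk
    rw [← Nat.card_congr (Equiv.ofBijective φ hφ), Nat.card_fin]
  have hlpos : ∀ p, 0 < ℓ p := fun p => by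
    obtain ⟨x, rfl⟩ := hπ p
    rw [hℓ]; exact hpos x
  have hlog : HasSum (fun p : ι => -Complex.log (1 - u ^ ℓ p))
      (∑' m : ℕ, ((ptsOfPeriod f (m + 1)).ncard : ℂ) * (u ^ (m + 1) / (m + 1))) := by
    refine HasSum.sigma hfib fun p => ?_
    have : Finite {x // π x = p} := Nat.finite_of_card_ne_zero (by rw [hcard]; exact (hlpos p).ne')
    have := Fintype.ofFinite {x // π x = p}
    have hterm : ∀ x : {x // π x = p}, minimalPeriod f x.1.1 = ℓ p := fun x => by
      rw [← hℓ, x.2]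
    have hconst := hasSum_fintype fun _ : {x // π x = p} => -Complex.log (1 - u ^ ℓ p) / (ℓ p : ℂ)
    rw [Finset.sum_const, Finset.card_univ, ← Nat.card_eq_fintype_card, hcard, nsmul_eq_mul,
      mul_div_cancel₀ _ (Nat.cast_ne_zero.2 (hlpos p).ne')] at hconst
    simpa only [Function.comp, Equiv.sigmaFiberEquiv_apply, hterm] using hconst
  have hexp := hlog.cexp
  convert! hexp using 1
  funext p
  have h1 : (1 : ℂ) - u ^ ℓ p ≠ 0 := by
    intro h
    have := hlt _ (hlpos p)
    rw [← sub_eq_zero.1 h, norm_one] at this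
    exact lt_irrefl _ this
  rw [Function.comp, Complex.exp_neg, Complex.exp_log h1]

/-! ### Traces of powers and determinants in terms of eigenvalues. -/

namespace Matrix

-- Spectral mapping with multiplicities, without triangularisation: both sides are multiplicative in
-- p, and for p = X - a the claim is the characteristic polynomial evaluated at a.
open Polynomial in
theorem det_aeval_eq_prod_roots {K E : Type*} [Field K] [IsAlgClosed K] [Fintype E]
    [DecidableEq E] (T : Matrix E E K) (p : K[X]) :
    (aeval T p).det = (T.charpoly.roots.map fun r => p.eval r).prod := by
  have hsplit := (IsAlgClosed.splits T.charpoly).eq_prod_roots_of_monic T.charpoly_monic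
  have hcard : T.charpoly.roots.card = Fintype.card E := by
    rw [← (IsAlgClosed.splits T.charpoly).natDegree_eq_card_roots, charpoly_natDegree_eq_dim]
  have hlin : ∀ a : K, (aeval T (X - C a)).det
      = (T.charpoly.roots.map fun r => (X - C a).eval r).prod := by
    intro a
    have h1 : aeval T (X - C a) = -(scalar E a - T) := by
      simp [Algebra.algebraMap_eq_smul_one, smul_one_eq_diagonal]
    have h2 := congrArg (eval a) hsplit
    rw [eval_multiset_prod, Multiset.map_map, eval_charpoly] at h2
    rw [h1, det_neg, h2, ← hcard]
    have h3 := Multiset.prod_map_neg (T.charpoly.roots.map fun r => a - r)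
    rw [Multiset.card_map] at h3
    simpa [Multiset.map_map, Function.comp_def] using h3.symm
  have hp := (IsAlgClosed.splits p).eq_prod_roots
  have hmul : ∀ s : Multiset K, (aeval T (s.map fun a => X - C a).prod).det
      = (T.charpoly.roots.map fun r => (s.map fun a => X - C a).prod.eval r).prod := by
    intro s
    induction s using Multiset.induction_on with
    | empty => simp
    | cons a s ih =>
      rw [Multiset.map_cons, Multiset.prod_cons, map_mul, det_mul, ih, hlin,
        ← Multiset.prod_map_mul]
      simp only [eval_mul]
  rw [hp, map_mul, det_mul, hmul]
  simp only [eval_mul, Multiset.prod_map_mul, aeval_C, eval_C]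
  rw [Algebra.algebraMap_eq_smul_one, det_smul, det_one]
  simp [hcard]

open Polynomial in
theorem trace_pow_eq_sum_roots {K E : Type*} [Field K] [IsAlgClosed K] [Fintype E]
    [DecidableEq E] (T : Matrix E E K) (m : ℕ) :
    (T ^ m).trace = (T.charpoly.roots.map (· ^ m)).sum := by
  have : (T ^ m).charpoly = ((T.charpoly.roots.map (· ^ m)).map fun r => X - C r).prod := by
    refine Polynomial.funext fun x => ?_
    -- With p = x - X^m this evaluates the characteristic polynomial of T^m at an arbitrary x.
    have h := det_aeval_eq_prod_roots T (C x - X ^ m)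
    rw [eval_charpoly, eval_multiset_prod, Multiset.map_map, Multiset.map_map]
    simpa [Algebra.algebraMap_eq_smul_one, smul_one_eq_diagonal, Function.comp_def] using h
  rw [trace_eq_sum_roots_charpoly, this, roots_multiset_prod_X_sub_C]

open Polynomial in
theorem det_one_sub_smul_eq_prod_roots {K E : Type*} [Field K] [IsAlgClosed K] [Fintype E]
    [DecidableEq E] (T : Matrix E E K) (u : K) :
    (1 - u • T).det = (T.charpoly.roots.map fun r => 1 - u * r).prod := by
  have h := det_aeval_eq_prod_roots T (1 - C u * X)
  rw [map_sub, map_mul, map_one, aeval_C, aeval_X, ← Algebra.smul_def] at h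
  simpa using h

/-- `det (1 - u T) = exp (-∑ tr (T ^ m) u ^ m / m)`, together with the absolute convergence of the
series of traces, for `u` close to zero. -/
theorem eventually_summable_trace_pow {E : Type*} [Fintype E] [DecidableEq E]
    (T : Matrix E E ℂ) : ∀ᶠ u : ℂ in nhds 0,
      (Summable fun m : ℕ => ‖(T ^ (m + 1)).trace‖ * ‖u‖ ^ (m + 1)) ∧
      Complex.exp (∑' m : ℕ, (T ^ (m + 1)).trace * (u ^ (m + 1) / (m + 1)))
        = ((1 - u • T).det)⁻¹ := by
  have hsmall : ∀ᶠ u : ℂ in nhds 0, ∀ r ∈ T.charpoly.roots.toFinset, ‖u * r‖ < 1 := by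
    rw [Filter.eventually_all_finset]
    intro r _
    have : Filter.Tendsto (fun u : ℂ => ‖u * r‖) (nhds 0) (nhds 0) := by
      have h : Continuous fun u : ℂ => ‖u * r‖ := by fun_prop
      simpa using h.tendsto 0
    exact this.eventually_lt_const one_pos
  filter_upwards [hsmall] with u hu
  simp only [Multiset.mem_toFinset] at hu
  rw [det_one_sub_smul_eq_prod_roots]
  simp only [trace_pow_eq_sum_roots]
  generalize T.charpoly.roots = s at hu
  -- Induction on the multiset of eigenvalues: each eigenvalue r adds the Taylor series of -log(1 -
  -- ur), which converges absolutely because ‖ur‖ < 1.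
  have hlog : ∀ s : Multiset ℂ, (∀ r ∈ s, ‖u * r‖ < 1) →
      (Summable fun m : ℕ => ‖(s.map (· ^ (m + 1))).sum‖ * ‖u‖ ^ (m + 1)) ∧
      ∃ a, HasSum (fun m : ℕ => (s.map (· ^ (m + 1))).sum * (u ^ (m + 1) / (m + 1))) a ∧
        Complex.exp a = ((s.map fun r => 1 - u * r).prod)⁻¹ := by
    intro s
    induction s using Multiset.induction_on with
    | empty => exact fun _ => ⟨by simp, 0, by simp, by simp⟩
    | cons r s ih =>
      intro h
      obtain ⟨h1, a, h2, h3⟩ := ih fun r hr => h r (Multiset.mem_cons_of_mem hr)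
      have hr := h r (Multiset.mem_cons_self r s)
      constructor
      · have hgeo : Summable fun m : ℕ => ‖u * r‖ ^ (m + 1) :=
          (summable_nat_add_iff 1).2 (summable_geometric_of_lt_one (norm_nonneg _) hr)
        refine Summable.of_nonneg_of_le (fun m => by positivity) (fun m => ?_) (hgeo.add h1)
        rw [Multiset.map_cons, Multiset.sum_cons, norm_mul, mul_pow, mul_comm (‖u‖ ^ _),
          ← norm_pow r, ← add_mul]
        gcongr
        exact norm_add_le _ _
      · refine ⟨-Complex.log (1 - u * r) + a, ?_, ?_⟩
        · refine ((Complex.hasSum_taylorSeries_neg_log' hr).add h2).congr_fun fun m => ?_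
          rw [Multiset.map_cons, Multiset.sum_cons, mul_pow]
          ring
        · have h0 : 1 - u * r ≠ 0 := by
            intro h0
            rw [← sub_eq_zero.1 h0, norm_one] at hr
            exact lt_irrefl _ hr
          rw [Complex.exp_add, h3, Complex.exp_neg, Complex.exp_log h0, Multiset.map_cons,
            Multiset.prod_cons, mul_inv]
  obtain ⟨h1, a, h2, h3⟩ := hlog s hu
  exact ⟨h1, by rw [h2.tsum_eq, h3]⟩

end Matrix

/-! ### The shift on bi-infinite walks and the count of closed walks. -/

/-- The bi-infinite walks of a relation. -/
def BiWalk {E : Type*} (r : E → E → Prop) : Type _ := {x : ℤ → E // ∀ i, r (x i) (x (i + 1))}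

namespace BiWalk

variable {E : Type*} {r : E → E → Prop}

/-- The shift of a bi-infinite walk. -/
def shift (x : BiWalk r) : BiWalk r := ⟨fun i => x.1 (i + 1), fun i => x.2 (i + 1)⟩

theorem iterate_shift_apply (x : BiWalk r) (m : ℕ) (i : ℤ) :
    (shift^[m] x).1 i = x.1 (i + m) := by
  induction m generalizing i with
  | zero => simp
  | succ m ih =>
    rw [Function.iterate_succ_apply', shift, ih]
    push_cast
    ring_nf

theorem isPeriodicPt_shift_iff {x : BiWalk r} {m : ℕ} :
    Function.IsPeriodicPt shift m x ↔ ∀ i, x.1 (i + m) = x.1 i := by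
  refine ⟨fun h i => ?_, fun h => Subtype.ext (funext fun i => ?_)⟩
  · rw [← iterate_shift_apply, h.eq]
  · rw [iterate_shift_apply, h]

theorem apply_add_mul_of_isPeriodicPt {x : BiWalk r} {m : ℕ}
    (h : Function.IsPeriodicPt shift m x) (i k : ℤ) : x.1 (i + m * k) = x.1 i := by
  have h' := isPeriodicPt_shift_iff.1 h
  induction k with
  | zero => simp
  | succ k ih => rw [mul_add, mul_one, ← add_assoc, h', ih]
  | pred k ih => rw [← ih, ← h', mul_sub, mul_one]; ring_nf

theorem apply_emod_of_isPeriodicPt {x : BiWalk r} {m : ℕ}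
    (h : Function.IsPeriodicPt shift m x) (i : ℤ) : x.1 (i % m) = x.1 i := by
  conv_rhs => rw [← Int.emod_add_mul_ediv i m]
  exact (apply_add_mul_of_isPeriodicPt h _ _).symm

theorem apply_eq_of_isPeriodicPt {x : BiWalk r} {m : ℕ}
    (h : Function.IsPeriodicPt shift m x) {i j : ℤ} (hij : (i : ZMod m) = j) : x.1 i = x.1 j := by
  rw [← apply_emod_of_isPeriodicPt h i, ← apply_emod_of_isPeriodicPt h j,
    (ZMod.intCast_eq_intCast_iff' i j m).1 hij]

/-- Extend a closed walk of length `m` to a bi-infinite periodic walk. -/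
def ofClosed (m : ℕ) (y : Fin (m + 1 + 1) → E) (h0 : y 0 = y (Fin.last (m + 1)))
    (hy : ∀ i : Fin (m + 1), r (y i.castSucc) (y i.succ)) : BiWalk r :=
  ⟨fun i => y (Fin.castSucc (Fin.ofNat (m + 1) (i % ((m + 1 : ℕ) : ℤ)).toNat)), fun i => by
    have key : y (Fin.castSucc (Fin.ofNat (m + 1) ((i + 1) % ((m + 1 : ℕ) : ℤ)).toNat))
        = y (Fin.succ (Fin.ofNat (m + 1) (i % ((m + 1 : ℕ) : ℤ)).toNat)) := by
      have hpos : (0 : ℤ) < ((m + 1 : ℕ) : ℤ) := by positivity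
      have h1 := Int.emod_nonneg i hpos.ne'
      have h2 := Int.emod_lt_of_pos i hpos
      obtain ⟨k, hk⟩ := Int.eq_ofNat_of_zero_le h1
      have h3 : (i + 1) % ((m + 1 : ℕ) : ℤ) = ((k + 1 : ℕ) : ℤ) % ((m + 1 : ℕ) : ℤ) := by
        rw [Int.add_emod, hk]; simp
      rw [h3, hk, ← Int.natCast_mod, Int.toNat_natCast, Int.toNat_natCast]
      have hk' : k < m + 1 := by omega
      rcases Nat.lt_or_ge (k + 1) (m + 1) with hlt | hge
      · congr 1
        ext
        simp [Nat.mod_eq_of_lt hlt, Nat.mod_eq_of_lt hk']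
      -- The wrap-around: the successor of the last residue is 0, and the walk closes up there by
      -- `h0`.
      · have : k = m := by omega
        subst this
        convert! h0 using 2
        · ext; simp
        · ext; simp
    have h := hy (Fin.ofNat (m + 1) (i % ((m + 1 : ℕ) : ℤ)).toNat)
    rw [← key] at h
    exact h⟩

/-- The points of period `m + 1` of the shift are the closed walks of length `m + 1`. -/
noncomputable def ptsOfPeriodEquiv (m : ℕ) :
    Function.ptsOfPeriod (shift (r := r)) (m + 1) ≃
      {y : Fin (m + 1 + 1) → E // y 0 = y (Fin.last (m + 1)) ∧
        ∀ i : Fin (m + 1), r (y i.castSucc) (y i.succ)} where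
  toFun x := ⟨fun i => x.1.1 (i : ℕ), by
    refine ⟨?_, fun i => ?_⟩
    · have := isPeriodicPt_shift_iff.1 x.2 0
      rw [zero_add] at this
      simpa using this.symm
    · simpa using x.1.2 (i : ℕ)⟩
  invFun y := ⟨ofClosed m y.1 y.2.1 y.2.2, by
    refine isPeriodicPt_shift_iff.2 fun i => ?_
    simp [ofClosed]⟩
  left_inv x := by
    refine Subtype.ext (Subtype.ext (funext fun i => ?_))
    have hpos : (0 : ℤ) < ((m + 1 : ℕ) : ℤ) := by positivity
    have h1 := Int.emod_nonneg i hpos.ne'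
    have h2 := Int.emod_lt_of_pos i hpos
    rw [← apply_emod_of_isPeriodicPt x.2 i]
    simp only [ofClosed, Fin.val_castSucc, Fin.val_ofNat]
    rw [Nat.mod_eq_of_lt (by omega), Int.toNat_of_nonneg h1]
  right_inv y := by
    refine Subtype.ext (funext fun i => ?_)
    simp only [ofClosed]
    rcases Nat.lt_or_ge i (m + 1) with hlt | hge
    · refine congrArg y.1 (Fin.ext ?_)
      rw [← Int.natCast_mod, Int.toNat_natCast]
      simp [Nat.mod_eq_of_lt hlt]
    · have hi : i = Fin.last (m + 1) := Fin.ext (by have := i.2; simp; omega)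
      subst hi
      rw [← y.2.1]
      refine congrArg y.1 (Fin.ext ?_)
      simp

end BiWalk

theorem Matrix.pow_apply_eq_sum_paths {E R : Type*} [Fintype E] [DecidableEq E] [CommSemiring R]
    (T : Matrix E E R) (m : ℕ) (a b : E) :
    (T ^ m) a b = ∑ y : Fin (m + 1) → E, if y 0 = a ∧ y (Fin.last m) = b then
      ∏ i : Fin m, T (y i.castSucc) (y i.succ) else 0 := by
  induction m generalizing a with
  | zero =>
    rw [← (Equiv.funUnique (Fin 1) E).symm.sum_comp]
    simp only [pow_zero, Matrix.one_apply, Equiv.funUnique_symm_apply, uniqueElim_const,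
      Finset.univ_eq_empty, Finset.prod_empty]
    by_cases h : a = b
    · subst h; simp
    · rw [if_neg h, Finset.sum_eq_zero]
      rintro c -
      rw [if_neg]
      rintro ⟨rfl, h'⟩
      exact h h'
  | succ m ih =>
    rw [pow_succ', Matrix.mul_apply]
    symm
    rw [← (Fin.consEquiv fun _ => E).sum_comp, Fintype.sum_prod_type, Finset.sum_eq_single a]
    · simp only [ih, Finset.mul_sum]
      rw [Finset.sum_comm]
      refine Finset.sum_congr rfl fun y _ => ?_
      simp only [Fin.consEquiv_apply, Fin.cons_zero, true_and, ← Fin.succ_last, Fin.cons_succ,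
        Fin.prod_univ_succ, Fin.castSucc_zero, Fin.castSucc_succ, mul_ite, mul_zero]
      rw [Finset.sum_eq_single (y 0)]
      · simp
      · intro c _ hc
        rw [if_neg fun h => hc h.1.symm]
      · simp
    · intro c _ hc
      refine Finset.sum_eq_zero fun y _ => ?_
      rw [if_neg]
      simp [hc]
    · simp

-- The trace sums over closed sequences of vertices, and the product of 0/1 entries along such a
-- sequence tests whether it is a walk.
open scoped Classical in
theorem Matrix.trace_pow_eq_ncard_ptsOfPeriod {E : Type*} [Fintype E] [DecidableEq E]
    (r : E → E → Prop) (m : ℕ) :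
    ((Matrix.of fun a b => if r a b then (1 : ℂ) else 0) ^ (m + 1)).trace
      = ((Function.ptsOfPeriod (BiWalk.shift (r := r)) (m + 1)).ncard : ℂ) := by
  rw [← Nat.card_coe_set_eq, Nat.card_congr (BiWalk.ptsOfPeriodEquiv m), Nat.card_eq_fintype_card,
    Fintype.card_subtype, Finset.card_filter, Matrix.trace]
  simp only [Matrix.diag_apply, Matrix.pow_apply_eq_sum_paths]
  rw [Finset.sum_comm]
  push_cast
  refine Finset.sum_congr rfl fun y _ => ?_
  rw [Finset.sum_eq_single (y 0)]
  · simp only [true_and, Matrix.of_apply, Finset.prod_ite_zero, Finset.mem_univ, true_implies,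
      Finset.prod_const_one, eq_comm (a := y (Fin.last (m + 1)))]
    rw [← ite_and]
  · intro c _ hc
    rw [if_neg fun h => hc h.1.symm]
  · simp

/-! ### Step matrices of incidence structures and Bass's formula. -/

namespace Incidence

open scoped Matrix

variable {A B : Type*} (inc : A → B → Prop)

/-- The flags of an incidence relation. -/
abbrev Flag {A B : Type*} (inc : A → B → Prop) : Type _ := {p : A × B // inc p.1 p.2}

open scoped Classical in
theorem sum_flag {A B M : Type*} [Fintype A] [Fintype B] (inc : A → B → Prop) [AddCommMonoid M]
    (g : A → B → M) :
    ∑ e : Flag inc, g e.1.1 e.1.2 = ∑ a, ∑ b, if inc a b then g a b else 0 := by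
  rw [← Fintype.sum_prod_type', ← Finset.sum_filter]
  exact (Finset.sum_subtype (p := fun p : A × B => inc p.1 p.2)
    (Finset.univ.filter fun p : A × B => inc p.1 p.2) (by simp) fun p => g p.1 p.2).symm

/-- Two consecutive flags of a path without back-tracking. -/
def Step {A B : Type*} (inc : A → B → Prop) (e f : Flag inc) : Prop :=
  e.1.1 ≠ f.1.1 ∧ inc f.1.1 e.1.2 ∧ e.1.2 ≠ f.1.2

section

open scoped Classical

/-- The matrix of the steps between flags. -/
noncomputable def stepMatrix : Matrix (Flag inc) (Flag inc) ℂ :=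
  Matrix.of fun e f => if Step inc e f then 1 else 0

/-- The incidence matrix. -/
noncomputable def incMatrix : Matrix B A ℂ := Matrix.of fun b a => if inc a b then 1 else 0

/-- The incidence matrix between elements of `B` and flags. -/
noncomputable def flagRight [DecidableEq B] : Matrix B (Flag inc) ℂ :=
  Matrix.of fun b e => if e.1.2 = b then 1 else 0

/-- The incidence matrix between elements of `A` and flags. -/
noncomputable def flagLeft [DecidableEq A] : Matrix A (Flag inc) ℂ :=
  Matrix.of fun a e => if e.1.1 = a then 1 else 0

variable [Fintype A] [Fintype B]

/-- A step from (a, b) to (a', b') passes through the single intermediate flag (a', b). The first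
factor changes a while b is fixed, the second changes b while a' is fixed; subtracting 1 forbids
standing still. -/
theorem stepMatrix_eq_mul [DecidableEq A] [DecidableEq B] :
    stepMatrix inc = ((flagRight inc)ᵀ * flagRight inc - 1) *
      ((flagLeft inc)ᵀ * flagLeft inc - 1) := by
  have h1 : ∀ e f : Flag inc, ((flagRight inc)ᵀ * flagRight inc - 1 :
      Matrix (Flag inc) (Flag inc) ℂ) e f = if e.1.2 = f.1.2 ∧ e.1.1 ≠ f.1.1 then 1 else 0 := by
    intro e f
    have hef : e = f ↔ e.1.2 = f.1.2 ∧ e.1.1 = f.1.1 := by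
      rw [Subtype.ext_iff, Prod.ext_iff, and_comm]
    simp only [Matrix.sub_apply, Matrix.mul_apply, Matrix.transpose_apply, flagRight,
      Matrix.of_apply,
      Matrix.one_apply, hef]
    simp only [mul_ite, mul_one, mul_zero, Finset.sum_ite_eq, Finset.mem_univ, if_true]
    by_cases h1 : e.1.2 = f.1.2 <;> by_cases h2 : e.1.1 = f.1.1 <;> simp [h1, h2]
  have h2 : ∀ e f : Flag inc, ((flagLeft inc)ᵀ * flagLeft inc - 1 :
      Matrix (Flag inc) (Flag inc) ℂ) e f = if e.1.1 = f.1.1 ∧ e.1.2 ≠ f.1.2 then 1 else 0 := by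
    intro e f
    have hef : e = f ↔ e.1.2 = f.1.2 ∧ e.1.1 = f.1.1 := by
      rw [Subtype.ext_iff, Prod.ext_iff, and_comm]
    simp only [Matrix.sub_apply, Matrix.mul_apply, Matrix.transpose_apply, flagLeft,
      Matrix.of_apply,
      Matrix.one_apply, hef]
    simp only [mul_ite, mul_one, mul_zero, Finset.sum_ite_eq, Finset.mem_univ, if_true]
    by_cases h1 : e.1.2 = f.1.2 <;> by_cases h2 : e.1.1 = f.1.1 <;> simp [h1, h2]
  ext e f
  rw [Matrix.mul_apply]
  simp only [h1, h2]
  rw [sum_flag inc fun a b => (if e.1.2 = b ∧ e.1.1 ≠ a then (1 : ℂ) else 0) *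
    (if a = f.1.1 ∧ b ≠ f.1.2 then 1 else 0)]
  rw [Finset.sum_eq_single f.1.1, Finset.sum_eq_single e.1.2]
  · by_cases h1 : e.1.1 = f.1.1 <;> by_cases h2 : inc f.1.1 e.1.2 <;>
      by_cases h3 : e.1.2 = f.1.2 <;> simp [stepMatrix, Step, h1, h2, h3]
  · intro b _ hb
    simp [Ne.symm hb]
  · simp
  · intro a _ ha
    simp [ha]
  · simp

variable {inc}

theorem flagRight_mul_transpose [DecidableEq B] {d : ℕ} (hd : ∀ b, ∑ a, incMatrix inc b a = d) :
    flagRight inc * (flagRight inc)ᵀ = (d : ℂ) • 1 := by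
  ext b b'
  simp only [Matrix.mul_apply, Matrix.transpose_apply, flagRight, Matrix.of_apply]
  rw [sum_flag inc fun _ y => (if y = b then (1 : ℂ) else 0) * if y = b' then 1 else 0,
    Matrix.smul_apply, Matrix.one_apply, smul_eq_mul, ← hd b, Finset.sum_mul]
  refine Finset.sum_congr rfl fun a _ => ?_
  rw [Finset.sum_eq_single b]
  · simp [incMatrix]
    split_ifs <;> rfl
  · intro c _ hc; simp [hc]
  · simp

theorem flagLeft_mul_transpose [DecidableEq A] {d : ℕ} (hd : ∀ a, ∑ b, incMatrix inc b a = d) :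
    flagLeft inc * (flagLeft inc)ᵀ = (d : ℂ) • 1 := by
  ext a a'
  simp only [Matrix.mul_apply, Matrix.transpose_apply, flagLeft, Matrix.of_apply]
  rw [sum_flag inc fun x _ => (if x = a then (1 : ℂ) else 0) * if x = a' then 1 else 0,
    Matrix.smul_apply, Matrix.one_apply, smul_eq_mul, ← hd a, Finset.sum_mul, Finset.sum_eq_single
    a]
  · refine Finset.sum_congr rfl fun b _ => ?_
    simp [incMatrix]
    split_ifs <;> rfl
  · intro c _ hc; simp [hc]
  · simp

theorem flagRight_mul_flagLeft_transpose [DecidableEq A] [DecidableEq B] :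
    flagRight inc * (flagLeft inc)ᵀ = incMatrix inc := by
  ext b a
  simp only [Matrix.mul_apply, Matrix.transpose_apply, flagRight, flagLeft, Matrix.of_apply,
    incMatrix]
  rw [sum_flag inc fun x y => (if y = b then (1 : ℂ) else 0) * if x = a then 1 else 0,
    Finset.sum_eq_single a, Finset.sum_eq_single b]
  · simp
  · intro c _ hc; simp [hc]
  · simp
  · intro c _ hc; simp [hc]
  · simp

variable (inc)

theorem card_flag {d : ℕ} (hd : ∀ b, ∑ a, incMatrix inc b a = d) :
    Fintype.card (Flag inc) = Fintype.card B * d := by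
  have h := sum_flag inc fun _ _ => (1 : ℂ)
  rw [Finset.sum_comm] at h
  have h' : ∀ b, ∑ a, (if inc a b then (1 : ℂ) else 0) = d := hd
  simp only [h', Finset.sum_const, Finset.card_univ, nsmul_eq_mul, mul_one] at h
  exact_mod_cast h

/-- **Bass's determinant formula** for a biregular incidence structure. -/
theorem det_one_sub_smul_stepMatrix [DecidableEq A] [DecidableEq B] {d₁ d₂ : ℕ}
    (h₁ : ∀ b, ∑ a, incMatrix inc b a = d₁)
    (h₂ : ∀ a, ∑ b, incMatrix inc b a = d₂) (u : ℂ) (hu : 1 - u ≠ 0)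
    (hu' : 1 + (d₂ - 1) * u ≠ 0) :
    (1 - u • stepMatrix inc).det =
      (1 - u) ^ ((Fintype.card B * d₁ : ℤ) - Fintype.card B - Fintype.card A) *
      (1 + (d₂ - 1) * u) ^ ((Fintype.card A : ℤ) - Fintype.card B) *
      (((1 + (d₁ - 1) * u) * (1 + (d₂ - 1) * u)) • (1 : Matrix B B ℂ)
        - u • (incMatrix inc * (incMatrix inc)ᵀ)).det := by
  set S := flagRight inc
  set L := flagLeft inc
  set M := incMatrix inc
  set x := 1 - u
  set y := 1 + ((d₂ : ℂ) - 1) * u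
  have hSS : S * Sᵀ = (d₁ : ℂ) • 1 := flagRight_mul_transpose h₁
  have hLL : L * Lᵀ = (d₂ : ℂ) • 1 := flagLeft_mul_transpose h₂
  have hSL : S * Lᵀ = M := flagRight_mul_flagLeft_transpose
  have hLS : L * Sᵀ = Mᵀ := by rw [← hSL, Matrix.transpose_mul, Matrix.transpose_transpose]
  -- Expanding (SᵀS - 1)(LᵀL - 1) and using S Lᵀ = M shows 1 - uT to be (1 - u) plus a matrix
  -- factoring through A ⊕ B. Sylvester's identity det(1 + UV) = det(1 + VU) then moves the
  -- determinant from flags to A ⊕ B.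
  let U : Matrix (Flag inc) (A ⊕ B) ℂ := Matrix.fromCols Lᵀ Sᵀ
  let V : Matrix (A ⊕ B) (Flag inc) ℂ := Matrix.fromRows (u • L) (u • (S - M * L))
  have hUV : 1 - u • stepMatrix inc = x • 1 + U * V := by
    rw [stepMatrix_eq_mul, Matrix.fromCols_mul_fromRows, ← hSL]
    change 1 - u • ((Sᵀ * S - 1) * (Lᵀ * L - 1)) = _
    simp only [Matrix.mul_sub, Matrix.sub_mul, Matrix.mul_smul, smul_sub, Matrix.mul_assoc,
      Matrix.one_mul, Matrix.mul_one, x,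
      sub_smul, one_smul]
    abel
  have hVU : V * U = Matrix.fromBlocks ((u * d₂) • (1 : Matrix A A ℂ)) (u • Mᵀ)
      ((-u * (d₂ - 1)) • M) ((u * d₁) • (1 : Matrix B B ℂ) - u • (M * Mᵀ)) := by
    rw [Matrix.fromRows_mul_fromCols]
    congr 1
    · rw [Matrix.smul_mul, hLL, smul_smul]
    · rw [Matrix.smul_mul, hLS]
    · rw [Matrix.smul_mul, Matrix.sub_mul, hSL, Matrix.mul_assoc, hLL]
      ext i j; simp; ring
    · rw [Matrix.smul_mul, Matrix.sub_mul, hSS, Matrix.mul_assoc, hLS]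
      ext i j; simp; ring
  have hdet : (x • (1 : Matrix (Flag inc) (Flag inc) ℂ) + U * V).det
      = x ^ Fintype.card (Flag inc) * (1 + (x⁻¹ • V) * U).det := by
    rw [← Matrix.det_one_add_mul_comm, ← Matrix.det_smul]
    congr 1
    rw [smul_add, Matrix.mul_smul, smul_smul, mul_inv_cancel₀ hu, one_smul]
  have hdet' : x ^ Fintype.card (A ⊕ B) * (1 + (x⁻¹ • V) * U).det
      = (Matrix.fromBlocks (y • (1 : Matrix A A ℂ)) (u • Mᵀ)
      ((-u * (d₂ - 1)) • M) ((1 + (d₁ - 1) * u) • (1 : Matrix B B ℂ) - u • (M * Mᵀ))).det := by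
    rw [← Matrix.det_smul, smul_add, Matrix.smul_mul, smul_smul, mul_inv_cancel₀ hu, one_smul, hVU,
      ← Matrix.fromBlocks_one, Matrix.fromBlocks_smul, Matrix.fromBlocks_add]
    congr 2
    · rw [← add_smul]; congr 1; simp only [x, y]; ring
    · simp
    · simp
    · rw [← add_sub_assoc, ← add_smul]; congr 2; simp only [x]; ring
  have hblock : (Matrix.fromBlocks (y • (1 : Matrix A A ℂ)) (u • Mᵀ)
      ((-u * (d₂ - 1)) • M) ((1 + (d₁ - 1) * u) • (1 : Matrix B B ℂ) - u • (M * Mᵀ))).det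
      = y ^ Fintype.card A * ((y⁻¹) ^ Fintype.card B *
        (((1 + (d₁ - 1) * u) * y) • (1 : Matrix B B ℂ) - u • (M * Mᵀ)).det) := by
    -- Schur complement of the scalar A-block.
    let _ : Invertible (y • (1 : Matrix A A ℂ)) :=
      ⟨y⁻¹ • 1, by rw [Matrix.smul_mul, Matrix.one_mul, smul_smul, inv_mul_cancel₀ hu', one_smul],
        by rw [Matrix.smul_mul, Matrix.one_mul, smul_smul, mul_inv_cancel₀ hu', one_smul]⟩
    have hinv : ⅟(y • (1 : Matrix A A ℂ)) = y⁻¹ • 1 := rfl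
    rw [Matrix.det_fromBlocks₁₁, hinv, Matrix.det_smul, Matrix.det_one, mul_one, ← Matrix.det_smul]
    congr 2
    simp only [Matrix.mul_smul, Matrix.smul_mul, Matrix.mul_one, smul_sub, smul_smul]
    -- After scaling by y the coefficient of M Mᵀ is exactly u, because y - (d₂ - 1)u = 1.
    rw [sub_sub, ← add_smul]
    congr 2
    · field_simp
    · field_simp
      simp only [y]
      ring
  rw [hUV, hdet]
  have hx : x ^ Fintype.card (A ⊕ B) ≠ 0 := pow_ne_zero _ hu
  have h3 : (1 + (x⁻¹ • V) * U).det = (x ^ Fintype.card (A ⊕ B))⁻¹ * (y ^ Fintype.card A *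
      ((y⁻¹) ^ Fintype.card B *
        (((1 + (d₁ - 1) * u) * y) • (1 : Matrix B B ℂ) - u • (M * Mᵀ)).det)) := by
    rw [← hblock, ← hdet', inv_mul_cancel_left₀ hx]
  rw [h3, card_flag inc h₁, Fintype.card_sum, zpow_sub₀ hu', sub_sub, zpow_sub₀ hu,
    ← Nat.cast_mul, ← Nat.cast_add, zpow_natCast, zpow_natCast, zpow_natCast, zpow_natCast,
    inv_pow, add_comm (Fintype.card A)]
  ring

end

end Incidence

/-! ### Prime cycles as periodic orbits of the shift. -/

namespace PeriodicCubical

open Function Incidence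

variable {q : ℕ}

/-- The `(d-1)`-cubes of the lattice. -/
abbrev Facet (n : Fin q → ℕ) (d : ℕ) : Type := {c : Cube n // c.dim + 1 = d}

/-- The `d`-cubes of the lattice. -/
abbrev Cell (n : Fin q → ℕ) (d : ℕ) : Type := {c : Cube n // c.dim = d}

/-- Containment of a `(d-1)`-cube in a `d`-cube. -/
def IsFace (n : Fin q → ℕ) (d : ℕ) (τ : Facet n d) (σ : Cell n d) : Prop := τ.1.IsSubcube σ.1

/-- The bi-infinite geodesics of the `d`-skeleton. -/
abbrev Geodesic (n : Fin q → ℕ) (d : ℕ) : Type := BiWalk (Step (IsFace n d))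

variable {n : Fin q → ℕ} {d : ℕ}

namespace ClosedPath

theorem sub_self (c : ClosedPath n d) (i : ZMod c.len) : (c.τ i).IsSubcube (c.σ i) := by
  have h := c.sub_right (i - 1)
  rwa [sub_add_cancel] at h

/-- The bi-infinite geodesic winding around a closed geodesic. -/
def toWalk (c : ClosedPath n d) (hc : c.IsGeodesic) : Geodesic n d :=
  ⟨fun k => ⟨(⟨c.τ k, c.dim_τ k⟩, ⟨c.σ k, c.dim_σ k⟩), c.sub_self k⟩, fun k => by
    have h1 := c.τ_ne (k : ZMod c.len)
    have h2 := c.sub_left (k : ZMod c.len)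
    have h3 := hc (k : ZMod c.len)
    rw [← Int.cast_one, ← Int.cast_add] at h1 h2 h3
    exact ⟨fun h => h1 (congrArg Subtype.val h), h2, fun h => h3 (congrArg Subtype.val h)⟩⟩

theorem isPeriodicPt_toWalk (c : ClosedPath n d) (hc : c.IsGeodesic) :
    IsPeriodicPt BiWalk.shift c.len (c.toWalk hc) := by
  refine BiWalk.isPeriodicPt_shift_iff.2 fun k => ?_
  simp [toWalk]

/-- The closed geodesic traced by a periodic bi-infinite geodesic. -/
def ofWalk (x : Geodesic n d) (m : ℕ) (hm : 0 < m) (hx : IsPeriodicPt BiWalk.shift m x) :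
    ClosedPath n d :=
  have hsucc : ∀ i : ZMod m, x.1 ((i + 1).cast : ℤ) = x.1 ((i.cast : ℤ) + 1) := fun i =>
    BiWalk.apply_eq_of_isPeriodicPt hx (by simp)
  { len := m
    len_pos := hm
    τ := fun i => (x.1 (i.cast : ℤ)).1.1.1
    σ := fun i => (x.1 (i.cast : ℤ)).1.2.1
    dim_τ := fun i => (x.1 (i.cast : ℤ)).1.1.2
    dim_σ := fun i => (x.1 (i.cast : ℤ)).1.2.2
    τ_ne := fun i h => by
      rw [hsucc] at h
      exact (x.2 _).1 (Subtype.ext h)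
    sub_left := fun i => by
      rw [hsucc]
      exact (x.2 _).2.1
    sub_right := fun i => (x.1 ((i + 1).cast : ℤ)).2 }

variable (x : Geodesic n d) (m : ℕ) (hm : 0 < m) (hx : IsPeriodicPt BiWalk.shift m x)

theorem ofWalk_τ (k : ℤ) :
    (ofWalk x m hm hx).τ (k : ZMod (ofWalk x m hm hx).len) = (x.1 k).1.1.1 := by
  have h : x.1 ((k : ZMod m).cast : ℤ) = x.1 k := BiWalk.apply_eq_of_isPeriodicPt hx (by simp)
  change (x.1 ((k : ZMod m).cast : ℤ)).1.1.1 = _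
  rw [h]

theorem ofWalk_σ (k : ℤ) :
    (ofWalk x m hm hx).σ (k : ZMod (ofWalk x m hm hx).len) = (x.1 k).1.2.1 := by
  have h : x.1 ((k : ZMod m).cast : ℤ) = x.1 k := BiWalk.apply_eq_of_isPeriodicPt hx (by simp)
  change (x.1 ((k : ZMod m).cast : ℤ)).1.2.1 = _
  rw [h]

theorem isGeodesic_ofWalk : (ofWalk x m hm hx).IsGeodesic := fun i h => by
  have hsucc : x.1 ((i + 1).cast : ℤ) = x.1 ((i.cast : ℤ) + 1) :=
    BiWalk.apply_eq_of_isPeriodicPt (m := (ofWalk x m hm hx).len) hx (by simp)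
  change (x.1 (i.cast : ℤ)).1.2.1 = (x.1 ((i + 1).cast : ℤ)).1.2.1 at h
  rw [hsucc] at h
  exact (x.2 _).2.2 (Subtype.ext h)

/-- If the path repeated a geodesic c at least twice, `c.len` would be a period of the walk below
the minimal one. -/
theorem isPrime_ofWalk (h : m = minimalPeriod BiWalk.shift x) : (ofWalk x m hm hx).IsPrime := by
  refine ⟨isGeodesic_ofWalk x m hm hx, ?_⟩
  rintro ⟨r, hr, c, hc, hlen, hmul⟩
  have hper : IsPeriodicPt BiWalk.shift c.len x := by
    refine BiWalk.isPeriodicPt_shift_iff.2 fun k => ?_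
    refine Subtype.ext (Prod.ext (Subtype.ext ?_) (Subtype.ext ?_))
    · rw [← ofWalk_τ x m hm hx, ← ofWalk_τ x m hm hx, (hmul _).1, (hmul _).1]
      simp
    · rw [← ofWalk_σ x m hm hx, ← ofWalk_σ x m hm hx, (hmul _).2, (hmul _).2]
      simp
  have hle := hper.minimalPeriod_le c.len_pos
  have hlen' : m = r * c.len := hlen
  have := c.len_pos
  nlinarith

/-- Otherwise the length is r ≥ 2 times the minimal period, and the path traced over one minimal
period is a geodesic of which c is the r-multiple. -/
theorem IsPrime.minimalPeriod_toWalk {c : ClosedPath n d} (hc : c.IsPrime) :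
    minimalPeriod BiWalk.shift (c.toWalk hc.1) = c.len := by
  have hper := c.isPeriodicPt_toWalk hc.1
  obtain ⟨r, hr⟩ := hper.minimalPeriod_dvd
  by_contra hne
  have hpos := hper.minimalPeriod_pos c.len_pos
  refine hc.2 ⟨r, ?_, ofWalk (c.toWalk hc.1) _ hpos (isPeriodicPt_minimalPeriod _ _),
    isGeodesic_ofWalk _ _ _ _, ?_, fun k => ⟨(ofWalk_τ (c.toWalk hc.1) _ hpos _ k).symm, (ofWalk_σ
    (c.toWalk hc.1) _ hpos _ k).symm⟩⟩
  · have h0 : r ≠ 0 := by rintro rfl; have := c.len_pos; omega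
    have h1 : r ≠ 1 := by rintro rfl; exact hne (by omega)
    omega
  · rw [hr, mul_comm]; rfl

end ClosedPath

/-- The prime cycle traced by a periodic bi-infinite geodesic. -/
noncomputable def PrimeCycle.ofWalk (x : periodicPts (BiWalk.shift (r := Step (IsFace n d)))) :
    PrimeCycle n d :=
  Quotient.mk (primeSetoid n d) ⟨ClosedPath.ofWalk x.1 _ (minimalPeriod_pos_of_mem_periodicPts x.2)
    (isPeriodicPt_minimalPeriod _ _), ClosedPath.isPrime_ofWalk _ _ _ _ rfl⟩

theorem PrimeCycle.length_ofWalk (x : periodicPts (BiWalk.shift (r := Step (IsFace n d)))) :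
    (PrimeCycle.ofWalk x).length = minimalPeriod BiWalk.shift x.1 := rfl

theorem PrimeCycle.ofWalk_surjective :
    Surjective (PrimeCycle.ofWalk (n := n) (d := d)) := by
  intro p
  induction p using Quotient.inductionOn with
  | h c =>
    refine ⟨⟨c.1.toWalk c.2.1, mk_mem_periodicPts c.1.len_pos (c.1.isPeriodicPt_toWalk c.2.1)⟩,
      Quotient.sound ?_⟩
    refine ⟨c.2.minimalPeriod_toWalk, 0, fun k => ?_⟩
    rw [add_zero]
    exact ⟨(ClosedPath.ofWalk_τ (c.1.toWalk c.2.1) _ _ (isPeriodicPt_minimalPeriod _ _) k).symm,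
      (ClosedPath.ofWalk_σ (c.1.toWalk c.2.1) _ _ (isPeriodicPt_minimalPeriod _ _) k).symm⟩

theorem PrimeCycle.ofWalk_eq_iff (x y : periodicPts (BiWalk.shift (r := Step (IsFace n d)))) :
    PrimeCycle.ofWalk x = PrimeCycle.ofWalk y ↔ ∃ k, BiWalk.shift^[k] x.1 = y.1 := by
  refine Quotient.eq.trans ⟨?_, ?_⟩
  · rintro ⟨-, s, hs⟩
    have hpos := minimalPeriod_pos_of_mem_periodicPts x.2
    -- A cyclic permutation may shift by a negative integer; reducing modulo the period turns it
    -- into a forward iterate.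
    refine ⟨(s % (minimalPeriod BiWalk.shift x.1 : ℤ)).toNat, Subtype.ext (funext fun k => ?_)⟩
    have hy : y.1.1 k = x.1.1 (k + s) := by
      refine Subtype.ext (Prod.ext (Subtype.ext ?_) (Subtype.ext ?_))
      · exact ((ClosedPath.ofWalk_τ y.1 _ _ (isPeriodicPt_minimalPeriod _ _) k).symm.trans (hs
          k).1).trans (ClosedPath.ofWalk_τ x.1 _ _ (isPeriodicPt_minimalPeriod _ _) (k + s))
      · exact ((ClosedPath.ofWalk_σ y.1 _ _ (isPeriodicPt_minimalPeriod _ _) k).symm.trans (hs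
          k).2).trans (ClosedPath.ofWalk_σ x.1 _ _ (isPeriodicPt_minimalPeriod _ _) (k + s))
    rw [BiWalk.iterate_shift_apply, hy]
    refine BiWalk.apply_eq_of_isPeriodicPt (isPeriodicPt_minimalPeriod BiWalk.shift x.1) ?_
    rw [Int.toNat_of_nonneg (Int.emod_nonneg _ (by exact_mod_cast hpos.ne'))]
    push_cast
    simp
  · rintro ⟨k, hk⟩
    have hmin : minimalPeriod BiWalk.shift x.1 = minimalPeriod BiWalk.shift y.1 := by
      rw [← hk, minimalPeriod_apply_iterate x.2]
    have hval : ∀ i : ℤ, y.1.1 i = x.1.1 (i + k) := fun i => by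
      rw [← hk, BiWalk.iterate_shift_apply]
    refine ⟨hmin, k, fun i => ⟨?_, ?_⟩⟩
    · refine (ClosedPath.ofWalk_τ y.1 _ _ (isPeriodicPt_minimalPeriod _ _) i).trans (Eq.trans ?_
        (ClosedPath.ofWalk_τ x.1 _ _ (isPeriodicPt_minimalPeriod _ _) (i + k)).symm)
      rw [hval]
    · refine (ClosedPath.ofWalk_σ y.1 _ _ (isPeriodicPt_minimalPeriod _ _) i).trans (Eq.trans ?_
        (ClosedPath.ofWalk_σ x.1 _ _ (isPeriodicPt_minimalPeriod _ _) (i + k)).symm)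
      rw [hval]

instance [∀ i, NeZero (n i)] : Finite (Cube n) :=
  Finite.of_injective (fun c : Cube n => (c.dir, c.pos)) fun _ _ h =>
    Cube.ext (congrArg Prod.fst h) (congrArg Prod.snd h)

noncomputable instance [∀ i, NeZero (n i)] : Fintype (Cube n) := Fintype.ofFinite _

open scoped Classical in
/-- The Euler product of the `d`-skeleton is the reciprocal of a determinant. -/
theorem eventually_hasProd_eulerFactor [∀ i, NeZero (n i)] (d : ℕ) :
    ∀ᶠ u : ℂ in nhds 0, (1 - u • stepMatrix (IsFace n d)).det ≠ 0 ∧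
      HasProd (eulerFactor n d u) ((1 - u • stepMatrix (IsFace n d)).det)⁻¹ := by
  have hball : ∀ᶠ u : ℂ in nhds 0, ‖u‖ < 1 := by
    filter_upwards [Metric.ball_mem_nhds (0 : ℂ) one_pos] with u hu
    simpa using hu
  filter_upwards [hball, Matrix.eventually_summable_trace_pow (stepMatrix (IsFace n d))]
    with u hu ⟨hs, hexp⟩
  have htr : ∀ m : ℕ, ((stepMatrix (IsFace n d)) ^ (m + 1)).trace
      = ((ptsOfPeriod (BiWalk.shift (r := Step (IsFace n d))) (m + 1)).ncard : ℂ) := fun m =>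
    Matrix.trace_pow_eq_ncard_ptsOfPeriod _ m
  simp only [htr, Complex.norm_natCast] at hs hexp
  refine ⟨fun h0 => ?_, ?_⟩
  · rw [h0, inv_zero] at hexp
    exact Complex.exp_ne_zero _ hexp
  · rw [← hexp]
    refine hasProd_periodicOrbits BiWalk.shift PrimeCycle.ofWalk PrimeCycle.ofWalk_surjective
      PrimeCycle.ofWalk_eq_iff PrimeCycle.length PrimeCycle.length_ofWalk (fun m => ?_) u hu hs
    have : Finite (ptsOfPeriod (BiWalk.shift (r := Step (IsFace n d))) (m + 1)) :=
      Finite.of_equiv _ (BiWalk.ptsOfPeriodEquiv m).symm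
    exact Set.toFinite _

end PeriodicCubical

/-! ### Fourier transform of the incidence matrix. -/

namespace PeriodicCubical

open Incidence
open scoped Matrix Kronecker

variable {q : ℕ}

/-- The possible directions of a `(d-1)`-cube. -/
abbrev FacetDir (q d : ℕ) : Type := {D : Finset (Fin q) // D.card + 1 = d}

/-- The possible directions of a `d`-cube. -/
abbrev CellDir (q d : ℕ) : Type := {D : Finset (Fin q) // D.card = d}

variable (n : Fin q → ℕ) (d : ℕ)

/-- A `(d-1)`-cube is given by its directions and its position. -/
def facetEquiv : FacetDir q d × (∀ i, ZMod (n i)) ≃ Facet n d where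
  toFun p := ⟨⟨p.1.1, p.2⟩, p.1.2⟩
  invFun c := (⟨c.1.dir, c.2⟩, c.1.pos)
  left_inv _ := rfl
  right_inv _ := rfl

/-- A `d`-cube is given by its directions and its position. -/
def cellEquiv : CellDir q d × (∀ i, ZMod (n i)) ≃ Cell n d where
  toFun p := ⟨⟨p.1.1, p.2⟩, p.1.2⟩
  invFun c := (⟨c.1.dir, c.2⟩, c.1.pos)
  left_inv _ := rfl
  right_inv _ := rfl

variable {n d}

/-- In codimension one a single direction j is collapsed, to one of its two ends. This form depends
only on the direction sets and the difference of positions, so it is visibly translation invariant.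
-/
theorem Cube.isSubcube_iff {τ σ : Cube n} (h : τ.dim + 1 = σ.dim) :
    τ.IsSubcube σ ↔ ∃ j, (j ∉ τ.dir ∧ insert j τ.dir = σ.dir) ∧
      (τ.pos = σ.pos ∨ τ.pos = σ.pos + Pi.single j 1) := by
  constructor
  · intro hs
    have hsub : τ.dir ⊆ σ.dir := fun i hi => by
      rcases hs i with h1 | h1 | h1
      · exact h1.2.1
      · exact h1.2.1
      · exact absurd hi h1.1
    have hcov : τ.dir ⋖ σ.dir := by
      refine Finset.covBy_iff_card_sdiff_eq_one.2 ⟨hsub, ?_⟩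
      rw [Finset.card_sdiff_of_subset hsub]
      unfold Cube.dim at h
      omega
    obtain ⟨j, hj, hins⟩ := Finset.covBy_iff_exists_insert.1 hcov
    refine ⟨j, ⟨hj, hins⟩, ?_⟩
    have hoff : ∀ i, i ≠ j → τ.pos i = σ.pos i := fun i hi => by
      rcases hs i with h1 | h1 | h1
      · exact h1.2.2
      · exact absurd h1.2.1 (by rw [← hins, Finset.mem_insert]; tauto)
      · exact h1.2.2
    have hon : τ.pos j = σ.pos j ∨ τ.pos j = σ.pos j + 1 := by
      rcases hs j with h1 | h1 | h1
      · exact absurd h1.1 hj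
      · exact h1.2.2
      · exact Or.inl h1.2.2
    refine hon.imp (fun h1 => funext fun i => ?_) (fun h1 => funext fun i => ?_)
    · rcases eq_or_ne i j with rfl | hi
      · exact h1
      · exact hoff i hi
    · rcases eq_or_ne i j with rfl | hi
      · simpa using h1
      · simpa [hi] using hoff i hi
  · rintro ⟨j, ⟨hj, hins⟩, hpos⟩ i
    rcases eq_or_ne i j with rfl | hi
    · refine Or.inr (Or.inl ⟨hj, hins ▸ Finset.mem_insert_self _ _, ?_⟩)
      refine hpos.imp (fun h1 => congrFun h1 i) fun h1 => ?_
      simpa using congrFun h1 i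
    · have hval : τ.pos i = σ.pos i := by
        rcases hpos with h1 | h1
        · exact congrFun h1 i
        · simpa [hi] using congrFun h1 i
      have hmem : i ∈ σ.dir ↔ i ∈ τ.dir := by rw [← hins, Finset.mem_insert]; tauto
      by_cases hτ : i ∈ τ.dir
      · exact Or.inl ⟨hτ, hmem.2 hτ, hval⟩
      · exact Or.inr (Or.inr ⟨hτ, fun h1 => hτ (hmem.1 h1), hval⟩)

open scoped Classical in
theorem incMatrix_isFace_eq_sum (hn : ∀ i, 2 ≤ n i) (σ : Cell n d) (τ : Facet n d) :
    incMatrix (IsFace n d) σ τ = ∑ j, if j ∉ τ.1.dir ∧ insert j τ.1.dir = σ.1.dir then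
      ((if σ.1.pos = τ.1.pos then (1 : ℂ) else 0) +
        if σ.1.pos = τ.1.pos - Pi.single j 1 then 1 else 0) else 0 := by
  have hiff : IsFace n d τ σ ↔ _ := Cube.isSubcube_iff (by rw [τ.2, σ.2])
  simp only [incMatrix, Matrix.of_apply]
  have hflip : ∀ j, σ.1.pos = τ.1.pos - Pi.single j 1 ↔ τ.1.pos = σ.1.pos + Pi.single j 1 :=
    fun j => eq_sub_iff_add_eq.trans eq_comm
  by_cases h : ∃ j, j ∉ τ.1.dir ∧ insert j τ.1.dir = σ.1.dir
  · obtain ⟨j, hj⟩ := h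
    have huniq : ∀ i, (i ∉ τ.1.dir ∧ insert i τ.1.dir = σ.1.dir) → i = j := by
      rintro i ⟨hi, hi'⟩
      have := Finset.mem_insert_self i τ.1.dir
      rw [hi', ← hj.2, Finset.mem_insert] at this
      exact this.resolve_right hi
    rw [Finset.sum_eq_single j (fun i _ hi => if_neg fun h' => hi (huniq i h')) (by simp),
      if_pos hj]
    have hiff' : IsFace n d τ σ ↔
        σ.1.pos = τ.1.pos ∨ σ.1.pos = τ.1.pos - Pi.single j 1 := by
      rw [hiff, hflip, eq_comm (a := σ.1.pos)]
      refine ⟨?_, fun h => ⟨j, hj, h⟩⟩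
      rintro ⟨i, hi, h⟩
      rwa [huniq i hi] at h
    -- Side length at least 2 keeps the two positions distinct, so the sum of the two indicators is
    -- never 2.
    have hne : τ.1.pos ≠ τ.1.pos - Pi.single j 1 := by
      have : Fact (1 < n j) := ⟨hn j⟩
      intro h
      have h' := congrFun h j
      rw [Pi.sub_apply, Pi.single_eq_same] at h'
      exact one_ne_zero (sub_eq_self.1 h'.symm)
    by_cases h1 : σ.1.pos = τ.1.pos
    · have h2 : σ.1.pos ≠ τ.1.pos - Pi.single j 1 := h1 ▸ hne
      rw [if_pos (hiff'.2 (Or.inl h1)), if_pos h1, if_neg h2, add_zero]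
    · by_cases h2 : σ.1.pos = τ.1.pos - Pi.single j 1
      · rw [if_pos (hiff'.2 (Or.inr h2)), if_neg h1, if_pos h2, zero_add]
      · rw [if_neg fun h => (hiff'.1 h).elim h1 h2, if_neg h1, if_neg h2, zero_add]
  · rw [if_neg fun h' => h ((hiff.1 h').imp fun j hj => hj.1), Finset.sum_eq_zero]
    exact fun j _ => if_neg fun h' => h ⟨j, h'⟩

open scoped Classical in
theorem incMatrix_isFace (hn : ∀ i, 2 ≤ n i) (D : CellDir q d) (v : ∀ i, ZMod (n i))
    (E : FacetDir q d) (w : ∀ i, ZMod (n i)) :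
    incMatrix (IsFace n d) (cellEquiv n d (D, v)) (facetEquiv n d (E, w)) =
      ∑ j, if j ∉ E.1 ∧ insert j E.1 = D.1 then
        ((if v = w then (1 : ℂ) else 0) + if v = w - Pi.single j 1 then 1 else 0) else 0 :=
  incMatrix_isFace_eq_sum hn _ _

theorem sum_facetDir {M : Type*} [AddCommMonoid M] (D : CellDir q d) (j : Fin q)
    (f : Finset (Fin q) → M) :
    ∑ E : FacetDir q d, (if j ∉ E.1 ∧ insert j E.1 = D.1 then f E.1 else 0)
      = if j ∈ D.1 then f (D.1.erase j) else 0 := by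
  split_ifs with hj
  · rw [Finset.sum_eq_single ⟨D.1.erase j, by rw [Finset.card_erase_add_one hj, D.2]⟩]
    · rw [if_pos ⟨Finset.notMem_erase j _, Finset.insert_erase hj⟩]
    · rintro E - hE
      refine if_neg fun h => hE (Subtype.ext ?_)
      change E.1 = D.1.erase j
      rw [← h.2, Finset.erase_insert h.1]
    · simp
  · refine Finset.sum_eq_zero fun E _ => if_neg fun h => hj ?_
    rw [← h.2]
    exact Finset.mem_insert_self _ _

theorem sum_cellDir {M : Type*} [AddCommMonoid M] (E : FacetDir q d) (j : Fin q)
    (f : Finset (Fin q) → M) :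
    ∑ D : CellDir q d, (if j ∉ E.1 ∧ insert j E.1 = D.1 then f D.1 else 0)
      = if j ∉ E.1 then f (insert j E.1) else 0 := by
  split_ifs with hj
  · exact Finset.sum_eq_zero fun D _ => if_neg fun h => h.1 hj
  · rw [Finset.sum_eq_single ⟨insert j E.1, by rw [Finset.card_insert_of_notMem hj, E.2]⟩]
    · rw [if_pos ⟨hj, rfl⟩]
    · rintro D - hD
      exact if_neg fun h => hD (Subtype.ext h.2.symm)
    · simp

variable [∀ i, NeZero (n i)]

open scoped Classical in
theorem sum_incMatrix_facet (hn : ∀ i, 2 ≤ n i) (σ : Cell n d) :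
    ∑ τ, incMatrix (IsFace n d) σ τ = (2 * d : ℕ) := by
  obtain ⟨⟨D, v⟩, rfl⟩ := (cellEquiv n d).surjective σ
  rw [← (facetEquiv n d).sum_comp, Fintype.sum_prod_type]
  simp only [incMatrix_isFace hn]
  have h1 : ∀ E : FacetDir q d, ∑ w : (∀ i, ZMod (n i)), (∑ j,
      if j ∉ E.1 ∧ insert j E.1 = D.1 then ((if v = w then (1 : ℂ) else 0) +
        if v = w - Pi.single j 1 then 1 else 0) else 0)
      = ∑ j, if j ∉ E.1 ∧ insert j E.1 = D.1 then 2 else 0 := by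
    intro E
    rw [Finset.sum_comm]
    refine Finset.sum_congr rfl fun j _ => ?_
    split_ifs
    · simp only [Finset.sum_add_distrib, eq_sub_iff_add_eq, Finset.sum_ite_eq, Finset.mem_univ,
        if_true]
      norm_num
    · simp
  simp only [h1]
  rw [Finset.sum_comm]
  have h2 := fun j => sum_facetDir D j fun _ => (2 : ℂ)
  simp only [h2, Finset.sum_ite_mem, Finset.univ_inter, Finset.sum_const, nsmul_eq_mul]
  rw [D.2]
  push_cast
  ring

open scoped Classical in
theorem sum_incMatrix_cell (hn : ∀ i, 2 ≤ n i) (τ : Facet n d) :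
    ∑ σ, incMatrix (IsFace n d) σ τ = (2 * (q + 1 - d) : ℕ) := by
  obtain ⟨⟨E, w⟩, rfl⟩ := (facetEquiv n d).surjective τ
  rw [← (cellEquiv n d).sum_comp, Fintype.sum_prod_type]
  simp only [incMatrix_isFace hn]
  have h1 : ∀ D : CellDir q d, ∑ v : (∀ i, ZMod (n i)), (∑ j,
      if j ∉ E.1 ∧ insert j E.1 = D.1 then ((if v = w then (1 : ℂ) else 0) +
        if v = w - Pi.single j 1 then 1 else 0) else 0)
      = ∑ j, if j ∉ E.1 ∧ insert j E.1 = D.1 then 2 else 0 := by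
    intro D
    rw [Finset.sum_comm]
    refine Finset.sum_congr rfl fun j _ => ?_
    split_ifs
    · simp only [Finset.sum_add_distrib, Finset.sum_ite_eq', Finset.mem_univ, if_true]
      norm_num
    · simp
  simp only [h1]
  rw [Finset.sum_comm]
  have h2 := fun j => sum_cellDir E j fun _ => (2 : ℂ)
  simp only [h2]
  simp only [← Finset.mem_compl, Finset.sum_ite_mem, Finset.univ_inter, Finset.sum_const,
    nsmul_eq_mul, Finset.card_compl, Fintype.card_fin]
  rw [show q - E.1.card = q + 1 - d by have h := E.2; omega]
  push_cast
  ring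

/-- The characters of `∏ ℤ / n i ℤ`. -/
noncomputable def torusChar (k v : ∀ i, ZMod (n i)) : ℂ := ∏ i, ZMod.stdAddChar (k i * v i)

theorem torusChar_add (k v w : ∀ i, ZMod (n i)) :
    torusChar k (v + w) = torusChar k v * torusChar k w := by
  simp only [torusChar, Pi.add_apply, mul_add, AddChar.map_add_eq_mul, Finset.prod_mul_distrib]

theorem torusChar_single (k : ∀ i, ZMod (n i)) (j : Fin q) (a : ZMod (n j)) :
    torusChar k (Pi.single j a) = ZMod.stdAddChar (k j * a) := by
  rw [torusChar, Finset.prod_eq_single j]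
  · simp
  · intro i _ hi
    simp [hi]
  · simp

theorem torusChar_sub_single (k v : ∀ i, ZMod (n i)) (j : Fin q) :
    torusChar k (v - Pi.single j 1) = torusChar k v * ZMod.stdAddChar (-k j) := by
  rw [sub_eq_add_neg, ← Pi.single_neg, torusChar_add, torusChar_single, mul_neg, mul_one]

theorem torusChar_add_single (k v : ∀ i, ZMod (n i)) (j : Fin q) :
    torusChar k (v + Pi.single j 1) = torusChar k v * ZMod.stdAddChar (k j) := by
  rw [torusChar_add, torusChar_single, mul_one]

theorem sum_torusChar (v : ∀ i, ZMod (n i)) :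
    ∑ k, torusChar k v = if v = 0 then ((∏ i, n i : ℕ) : ℂ) else 0 := by
  classical
  simp only [torusChar]
  rw [← Fintype.prod_sum fun i (x : ZMod (n i)) => ZMod.stdAddChar (x * v i)]
  simp only [AddChar.sum_mulShift _ (ZMod.isPrimitive_stdAddChar _), ZMod.card]
  split_ifs with h
  · subst h; simp
  · obtain ⟨i, hi⟩ := Function.ne_iff.1 h
    refine Finset.prod_eq_zero (Finset.mem_univ i) ?_
    rw [if_neg (show ¬v i = 0 from hi), Nat.cast_zero]

variable (n) in
/-- The matrix of the discrete Fourier transform on `∏ ℤ / n i ℤ`. -/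
noncomputable def fourierMatrix : Matrix (∀ i, ZMod (n i)) (∀ i, ZMod (n i)) ℂ :=
  Matrix.of fun v k => torusChar k v

/-- Orthogonality of characters: the conjugate transform inverts it up to the factor ∏ n_i. -/
theorem det_fourierMatrix_ne_zero : (fourierMatrix n).det ≠ 0 := by
  have h : fourierMatrix n * Matrix.of (fun k v => torusChar k (-v))
      = ((∏ i, n i : ℕ) : ℂ) • 1 := by
    ext v w
    simp only [Matrix.mul_apply, fourierMatrix, Matrix.of_apply, ← torusChar_add, sum_torusChar,
      Matrix.smul_apply, Matrix.one_apply, ← sub_eq_add_neg, sub_eq_zero, smul_eq_mul, mul_ite,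
      mul_one, mul_zero]
  intro h0
  have h' := congrArg Matrix.det h
  rw [Matrix.det_mul, h0, zero_mul, Matrix.det_smul, Matrix.det_one, mul_one] at h'
  refine pow_ne_zero _ ?_ h'.symm
  exact_mod_cast Finset.prod_ne_zero_iff.2 fun i _ => NeZero.ne (n i)

variable (n d)

/-- The Fourier transform of the incidence matrix at `k`. -/
noncomputable def incSymbol (k : ∀ i, ZMod (n i)) : Matrix (CellDir q d) (FacetDir q d) ℂ :=
  Matrix.of fun D E => ∑ j, if j ∉ E.1 ∧ insert j E.1 = D.1 then 1 + ZMod.stdAddChar (k j) else 0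

/-- The Fourier transform of the transposed incidence matrix at `k`. -/
noncomputable def incSymbolTranspose (k : ∀ i, ZMod (n i)) :
    Matrix (FacetDir q d) (CellDir q d) ℂ :=
  Matrix.of fun E D => ∑ j, if j ∉ E.1 ∧ insert j E.1 = D.1 then 1 + ZMod.stdAddChar (-k j) else 0

-- Incidence is a sum of translations by 0 and by a unit vector, so on each character it acts by the
-- scalars 1 + χ(k_j), mixing only the direction sets.
open scoped Classical in
theorem incMatrix_mul_fourier (hn : ∀ i, 2 ≤ n i) :
    (incMatrix (IsFace n d)).submatrix (cellEquiv n d) (facetEquiv n d) *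
      ((1 : Matrix (FacetDir q d) (FacetDir q d) ℂ) ⊗ₖ fourierMatrix n)
    = ((1 : Matrix (CellDir q d) (CellDir q d) ℂ) ⊗ₖ fourierMatrix n) *
      Matrix.blockDiagonal (incSymbol n d) := by
  ext ⟨D, v⟩ ⟨E, k⟩
  simp only [Matrix.mul_apply, Fintype.sum_prod_type, Matrix.kroneckerMap_apply, Matrix.one_apply,
    Matrix.submatrix_apply, incMatrix_isFace hn,
    Matrix.blockDiagonal_apply, fourierMatrix, Matrix.of_apply, ite_mul, one_mul, zero_mul,
    mul_ite, mul_zero]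
  rw [Finset.sum_comm]
  simp only [Finset.sum_ite_eq, Finset.sum_ite_eq', Finset.mem_univ, if_true, Finset.sum_mul]
  rw [Finset.sum_comm]
  simp only [incSymbol, Matrix.of_apply, Finset.mul_sum]
  refine Finset.sum_congr rfl fun j _ => ?_
  split_ifs
  · simp only [add_mul, ite_mul, one_mul, zero_mul, Finset.sum_add_distrib, eq_sub_iff_add_eq,
      Finset.sum_ite_eq, Finset.mem_univ, if_true, torusChar_add_single]
    ring
  · simp

open scoped Classical in
theorem incMatrix_transpose_mul_fourier (hn : ∀ i, 2 ≤ n i) :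
    ((incMatrix (IsFace n d)).submatrix (cellEquiv n d) (facetEquiv n d))ᵀ *
      ((1 : Matrix (CellDir q d) (CellDir q d) ℂ) ⊗ₖ fourierMatrix n)
    = ((1 : Matrix (FacetDir q d) (FacetDir q d) ℂ) ⊗ₖ fourierMatrix n) *
      Matrix.blockDiagonal (incSymbolTranspose n d) := by
  ext ⟨E, v⟩ ⟨D, k⟩
  simp only [Matrix.mul_apply, Fintype.sum_prod_type, Matrix.kroneckerMap_apply, Matrix.one_apply,
    Matrix.submatrix_apply, Matrix.transpose_apply, incMatrix_isFace hn,
    Matrix.blockDiagonal_apply, fourierMatrix, Matrix.of_apply, ite_mul, one_mul,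
    zero_mul, mul_ite, mul_zero]
  rw [Finset.sum_comm]
  simp only [Finset.sum_ite_eq, Finset.sum_ite_eq', Finset.mem_univ, if_true, Finset.sum_mul]
  rw [Finset.sum_comm]
  simp only [incSymbolTranspose, Matrix.of_apply, Finset.mul_sum]
  refine Finset.sum_congr rfl fun j _ => ?_
  split_ifs
  · simp only [add_mul, ite_mul, one_mul, zero_mul, Finset.sum_add_distrib,
      Finset.sum_ite_eq', Finset.mem_univ, if_true, torusChar_sub_single]
    ring
  · simp

open scoped Classical in
/-- The determinant of `c - u M Mᵀ`, with `M` the incidence matrix, splits over the characters. -/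
theorem det_smul_one_sub_incMatrix (hn : ∀ i, 2 ≤ n i) (c u : ℂ) :
    (c • (1 : Matrix (Cell n d) (Cell n d) ℂ)
      - u • (incMatrix (IsFace n d) * (incMatrix (IsFace n d))ᵀ)).det
    = ∏ k : (∀ i, ZMod (n i)), (c • 1 - u • (incSymbol n d k * incSymbolTranspose n d k)).det := by
  set M := (incMatrix (IsFace n d)).submatrix (cellEquiv n d) (facetEquiv n d)
  set F := (1 : Matrix (CellDir q d) (CellDir q d) ℂ) ⊗ₖ fourierMatrix n
  have hF : F.det ≠ 0 := by
    rw [Matrix.det_kronecker, Matrix.det_one, one_pow, one_mul]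
    exact pow_ne_zero _ det_fourierMatrix_ne_zero
  have hsub : (c • (1 : Matrix (Cell n d) (Cell n d) ℂ)
      - u • (incMatrix (IsFace n d) * (incMatrix (IsFace n d))ᵀ)).submatrix (cellEquiv n d)
        (cellEquiv n d) = c • 1 - u • (M * Mᵀ) := by
    simp only [M, Matrix.transpose_submatrix, Matrix.submatrix_mul_equiv]
    rw [← Matrix.submatrix_one_equiv (cellEquiv n d)]
    rfl
  have hconj : (c • 1 - u • (M * Mᵀ)) * F = F * Matrix.blockDiagonal
      fun k => c • 1 - u • (incSymbol n d k * incSymbolTranspose n d k) := by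
    have hbd : Matrix.blockDiagonal
        (fun k => c • 1 - u • (incSymbol n d k * incSymbolTranspose n d k))
        = c • 1 - u • (Matrix.blockDiagonal (incSymbol n d) *
          Matrix.blockDiagonal (incSymbolTranspose n d)) := by
      rw [← Matrix.blockDiagonal_mul, ← Matrix.blockDiagonal_smul, ← Matrix.blockDiagonal_one,
        ← Matrix.blockDiagonal_smul, ← Matrix.blockDiagonal_sub]
      rfl
    rw [hbd, Matrix.sub_mul, Matrix.mul_sub, Matrix.smul_mul, Matrix.smul_mul, Matrix.mul_smul,
      Matrix.mul_smul, Matrix.one_mul, Matrix.mul_one, Matrix.mul_assoc,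
      incMatrix_transpose_mul_fourier n d hn, ← Matrix.mul_assoc, incMatrix_mul_fourier n d hn,
      Matrix.mul_assoc]
  rw [← Matrix.det_submatrix_equiv_self (cellEquiv n d), hsub, ← Matrix.det_blockDiagonal]
  have h := congrArg Matrix.det hconj
  rw [Matrix.det_mul, Matrix.det_mul, mul_comm] at h
  exact mul_left_cancel₀ hF h

variable {n d} in
theorem incSymbol_mul_apply (k : ∀ i, ZMod (n i)) (D D' : CellDir q d) :
    (incSymbol n d k * incSymbolTranspose n d k) D D'
      = ∑ j, ∑ i, if j ∈ D.1 ∧ i ∉ D.1.erase j ∧ insert i (D.1.erase j) = D'.1 then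
        (1 + ZMod.stdAddChar (k j)) * (1 + ZMod.stdAddChar (-k i)) else 0 := by
  simp only [Matrix.mul_apply, incSymbol, incSymbolTranspose, Matrix.of_apply, Finset.sum_mul,
    ite_mul, zero_mul]
  rw [Finset.sum_comm]
  refine Finset.sum_congr rfl fun j _ => ?_
  rw [sum_facetDir D j fun E => (1 + ZMod.stdAddChar (k j)) *
    ∑ i, if i ∉ E ∧ insert i E = D'.1 then 1 + ZMod.stdAddChar (-k i) else 0]
  split_ifs with hj
  · rw [Finset.mul_sum]
    refine Finset.sum_congr rfl fun i _ => ?_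
    simp [hj]
  · simp [hj]

end PeriodicCubical

/-! ### Rank-one perturbations and elementary symmetric polynomials. -/

/-- The matrix determinant lemma, with the inverse of the diagonal cleared into products over the
remaining indices. -/
theorem Matrix.det_diagonal_sub_vecMulVec {m K : Type*} [Fintype m] [DecidableEq m] [Field K]
    (t x y : m → K) (ht : ∀ a, t a ≠ 0) (u : K) :
    (Matrix.of fun a b => (if a = b then t a else 0) - u * (y a * x b)).det
      = ∏ a, t a - u * ∑ a, x a * y a * ∏ b ∈ Finset.univ.erase a, t b := by
  have hdet : IsUnit (Matrix.diagonal t).det := by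
    rw [Matrix.det_diagonal]
    exact (Finset.prod_ne_zero_iff.2 fun a _ => ht a).isUnit
  have hinv : (Matrix.diagonal t)⁻¹ = Matrix.diagonal fun a => (t a)⁻¹ := by
    refine Matrix.inv_eq_right_inv ?_
    rw [Matrix.diagonal_mul_diagonal, ← Matrix.diagonal_one]
    congr 1
    funext a
    exact mul_inv_cancel₀ (ht a)
  have h := Matrix.det_add_replicateCol_mul_replicateRow (ι := Unit) hdet (fun a => -u * y a) x
  rw [hinv, Matrix.det_unique (1 + _), Matrix.det_diagonal] at h
  convert! h using 1
  · congr 1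
    ext a b
    simp only [Matrix.of_apply, Matrix.add_apply, Matrix.diagonal_apply, Matrix.mul_apply,
      Matrix.replicateCol_apply, Matrix.replicateRow_apply, Finset.univ_unique,
      Finset.sum_singleton]
    ring
  · rw [Matrix.add_apply, Matrix.one_apply_eq, Matrix.mul_apply]
    simp only [Matrix.mul_diagonal, Matrix.replicateCol_apply, Matrix.replicateRow_apply]
    rw [mul_add, mul_one, sub_eq_add_neg, ← neg_mul, Finset.mul_sum, Finset.mul_sum]
    congr 1
    refine Finset.sum_congr rfl fun a _ => ?_
    rw [← Finset.mul_prod_erase Finset.univ t (Finset.mem_univ a)]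
    have := ht a
    field_simp

theorem Finset.prod_add_mul_eq_sum_esymm {m R : Type*} [Fintype m] [CommRing R] (w : m → R)
    (X s : R) :
    ∏ a, (X + s * w a) = ∑ l ∈ Finset.range (Fintype.card m + 1),
      MvPolynomial.eval w (MvPolynomial.esymm m R l) * X ^ (Fintype.card m - l) * s ^ l := by
  classical
  simp only [add_comm X, Finset.prod_add, Finset.sum_powerset, Finset.card_univ]
  refine Finset.sum_congr rfl fun l _ => ?_
  simp only [MvPolynomial.esymm, map_sum, map_prod, MvPolynomial.eval_X, Finset.sum_mul]
  refine Finset.sum_congr rfl fun t ht => ?_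
  rw [Finset.mem_powersetCard] at ht
  rw [Finset.prod_mul_distrib, Finset.prod_const, Finset.prod_const, ht.2,
    Finset.card_sdiff_of_subset ht.1, ht.2, Finset.card_univ]
  ring

/-- Both sides are the derivative in s of ∏ (X + s w_a), computed by the product rule and from its
expansion. -/
theorem Finset.sum_mul_prod_erase_eq_sum_esymm {m : Type*} [Fintype m] [DecidableEq m]
    (w : m → ℂ) (X s : ℂ) :
    ∑ a, w a * ∏ b ∈ Finset.univ.erase a, (X + s * w b)
      = ∑ l ∈ Finset.range (Fintype.card m + 1),
      MvPolynomial.eval w (MvPolynomial.esymm m ℂ l) * X ^ (Fintype.card m - l) *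
        (l * s ^ (l - 1)) := by
  have h1 : HasDerivAt (fun s : ℂ => ∏ a, (X + s * w a))
      (∑ a, w a * ∏ b ∈ Finset.univ.erase a, (X + s * w b)) s := by
    have h := HasDerivAt.fun_finsetProd (u := Finset.univ) (f := fun a (s : ℂ) => X + s * w a)
      (f' := w) (x := s)
      fun a _ => by simpa using ((hasDerivAt_id s).mul_const (w a)).const_add X
    convert! h using 1
    refine Finset.sum_congr rfl fun a _ => ?_
    rw [smul_eq_mul, mul_comm]
  have h2 : HasDerivAt (fun s : ℂ => ∏ a, (X + s * w a))
      (∑ l ∈ Finset.range (Fintype.card m + 1),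
      MvPolynomial.eval w (MvPolynomial.esymm m ℂ l) * X ^ (Fintype.card m - l) *
        (l * s ^ (l - 1))) s := by
    simp only [Finset.prod_add_mul_eq_sum_esymm]
    exact HasDerivAt.fun_sum fun l _ => (hasDerivAt_pow l s).const_mul _
  exact h1.unique h2

/-! ### Determinants of the Fourier blocks for d = q and d = q - 1. -/

namespace PeriodicCubical

open Incidence
open scoped Matrix

variable {q : ℕ} {n : Fin q → ℕ}

/-- At s = 2u the coefficients combine as (2u)^l - u·l·(2u)^(l-1) = (2 - l) 2^(l-1) u^l, which is
where the weights in `FUp` come from. At l = 0 the truncated exponent l - 1 is harmless, since its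
factor l vanishes. -/
theorem sum_esymm_eq_prod_sub (w : Fin q → ℂ) (X u : ℂ) :
    ∑ l ∈ Finset.range (q + 1), (2 - (l : ℂ)) * (2 : ℂ) ^ ((l : ℤ) - 1) *
      MvPolynomial.eval w (MvPolynomial.esymm (Fin q) ℂ l) * X ^ (q - l) * u ^ l
    = ∏ a, (X + 2 * u * w a)
      - u * ∑ a, w a * ∏ b ∈ Finset.univ.erase a, (X + 2 * u * w b) := by
  rw [Finset.prod_add_mul_eq_sum_esymm, Finset.sum_mul_prod_erase_eq_sum_esymm, Fintype.card_fin,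
    Finset.mul_sum, ← Finset.sum_sub_distrib]
  refine Finset.sum_congr rfl fun l _ => ?_
  rw [zpow_sub_one₀ two_ne_zero, zpow_natCast]
  rcases l with _ | l
  · norm_num
  · rw [Nat.add_sub_cancel, mul_pow, mul_pow]
    push_cast
    ring

section Symbols

variable [∀ i, NeZero (n i)]

/-- `cos (2 π kᵢ / nᵢ)` for a residue `k`. -/
noncomputable def torusCos (k : ∀ i, ZMod (n i)) (i : Fin q) : ℂ :=
  (ZMod.stdAddChar (k i) + ZMod.stdAddChar (-k i)) / 2

theorem cosAngle_eq_torusCos (k : Fin q → ℕ) (i : Fin q) :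
    cosAngle n k i = torusCos (fun i => (k i : ZMod (n i))) i := by
  have h1 := ZMod.stdAddChar_coe (N := n i) (k i : ℤ)
  have h2 := ZMod.stdAddChar_coe (N := n i) (-(k i : ℤ))
  push_cast at h1 h2
  rw [torusCos, h1, h2, cosAngle, Complex.ofReal_cos, Complex.cos]
  push_cast
  congr 3
  · ring
  · ring

theorem one_add_stdAddChar_mul (k : ∀ i, ZMod (n i)) (i : Fin q) :
    (1 + ZMod.stdAddChar (k i)) * (1 + ZMod.stdAddChar (-k i)) = 2 + 2 * torusCos k i := by
  have h : (ZMod.stdAddChar (k i) * ZMod.stdAddChar (-k i) : ℂ) = 1 := by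
    rw [← AddChar.map_add_eq_mul, add_neg_cancel, AddChar.map_zero_eq_one]
  rw [torusCos]
  linear_combination h

theorem det_symbol_top (k : ∀ i, ZMod (n i)) (c u : ℂ) :
    (c • 1 - u • (incSymbol n q k * incSymbolTranspose n q k)).det
      = c - u * ∑ i, (2 + 2 * torusCos k i) := by
  let _ : Unique (CellDir q q) :=
    { default := ⟨Finset.univ, by simp⟩
      uniq := fun D => Subtype.ext ((Finset.card_eq_iff_eq_univ D.1).1 (by simp [D.2])) }
  rw [Matrix.det_unique, Matrix.sub_apply, Matrix.smul_apply, Matrix.smul_apply,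
    Matrix.one_apply_eq, smul_eq_mul, smul_eq_mul, mul_one, incSymbol_mul_apply]
  congr 2
  refine Finset.sum_congr rfl fun j _ => ?_
  rw [Finset.sum_eq_single j]
  · rw [if_pos, one_add_stdAddChar_mul]
    exact ⟨Finset.mem_univ j, Finset.notMem_erase _ _, Finset.insert_erase (Finset.mem_univ j)⟩
  · intro i _ hi
    exact if_neg fun h => h.2.1 (Finset.mem_erase.2 ⟨hi, Finset.mem_univ i⟩)
  · simp

theorem erase_univ_insert_eq_iff (a b i j : Fin q) :
    (j ∈ Finset.univ.erase a ∧ i ∉ (Finset.univ.erase a).erase j ∧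
      insert i ((Finset.univ.erase a).erase j) = Finset.univ.erase b) ↔
    j ≠ a ∧ ((i = j ∧ a = b) ∨ (i = a ∧ j = b)) := by
  simp only [Finset.ext_iff, Finset.mem_erase, Finset.mem_insert, Finset.mem_univ]
  constructor
  · rintro ⟨⟨hja, -⟩, hi, h⟩
    refine ⟨hja, ?_⟩
    have h1 := h b
    have h2 : i = j ∨ i = a := by tauto
    rcases h2 with rfl | rfl
    · left; tauto
    · right
      refine ⟨rfl, ?_⟩
      have h3 := h j
      tauto
  · rintro ⟨hja, ⟨rfl, rfl⟩ | ⟨rfl, rfl⟩⟩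
    · refine ⟨by tauto, by tauto, fun x => ?_⟩
      by_cases hx : x = i
      · subst hx; tauto
      · tauto
    · refine ⟨by tauto, by tauto, fun x => ?_⟩
      by_cases hx : x = i
      · subst hx; simp [Ne.symm hja]
      · tauto

/-- Each direction set omits one index. For a ≠ b the only route from D to D' removes b and inserts
a, giving a rank-one pattern. On the diagonal the sum of w_j over j ≠ a is written as (∑ w - 2 w_a)
+ w_a, with w_a the diagonal of that rank-one matrix. -/
theorem symbol_entry_codim_one (k : ∀ i, ZMod (n i)) (D D' : CellDir q (q - 1)) (a b : Fin q)
    (hD : D.1 = Finset.univ.erase a) (hD' : D'.1 = Finset.univ.erase b) :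
    (incSymbol n (q - 1) k * incSymbolTranspose n (q - 1) k) D D'
      = (if a = b then ∑ i, (2 + 2 * torusCos k i) - 2 * (2 + 2 * torusCos k a) else 0) +
        (1 + ZMod.stdAddChar (-k a)) * (1 + ZMod.stdAddChar (k b)) := by
  rw [incSymbol_mul_apply, hD, hD']
  simp only [erase_univ_insert_eq_iff]
  split_ifs with hab
  · subst hab
    have h1 : ∀ j, ∑ i, (if j ≠ a ∧ ((i = j ∧ a = a) ∨ (i = a ∧ j = a)) then
        (1 + ZMod.stdAddChar (k j)) * (1 + ZMod.stdAddChar (-k i)) else 0)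
        = if j ≠ a then 2 + 2 * torusCos k j else 0 := by
      intro j
      by_cases hj : j = a
      · simp [hj]
      · rw [if_pos hj, Finset.sum_eq_single j]
        · rw [if_pos ⟨hj, Or.inl ⟨rfl, rfl⟩⟩, one_add_stdAddChar_mul]
        · intro i _ hi
          rw [if_neg]
          tauto
        · simp
    rw [Finset.sum_congr rfl fun j _ => h1 j, mul_comm (1 + ZMod.stdAddChar (-k a)),
      one_add_stdAddChar_mul, ← Finset.add_sum_erase _ _ (Finset.mem_univ a),
      ← Finset.add_sum_erase _ (fun i => 2 + 2 * torusCos k i) (Finset.mem_univ a),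
      Finset.sum_congr rfl fun j hj => if_pos (Finset.ne_of_mem_erase hj)]
    rw [if_neg (by simp)]
    ring
  · rw [Finset.sum_eq_single b, Finset.sum_eq_single a]
    · rw [if_pos ⟨Ne.symm hab, Or.inr ⟨rfl, rfl⟩⟩]
      ring
    · intro i _ hi
      rw [if_neg]
      tauto
    · simp
    · intro j _ hj
      refine Finset.sum_eq_zero fun i _ => if_neg ?_
      tauto
    · simp

theorem det_symbol_codim_one (hq : 1 ≤ q) (k : ∀ i, ZMod (n i)) (c u : ℂ)
    (hc : ∀ a, c - u * ∑ i, (2 + 2 * torusCos k i) + 2 * u * (2 + 2 * torusCos k a) ≠ 0) :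
    (c • 1 - u • (incSymbol n (q - 1) k * incSymbolTranspose n (q - 1) k)).det
      = ∑ l ∈ Finset.range (q + 1), (2 - (l : ℂ)) * (2 : ℂ) ^ ((l : ℤ) - 1) *
        MvPolynomial.eval (fun i => 2 + 2 * torusCos k i) (MvPolynomial.esymm (Fin q) ℂ l) *
        (c - u * ∑ i, (2 + 2 * torusCos k i)) ^ (q - l) * u ^ l := by
  let f : Fin q → CellDir q (q - 1) := fun a => ⟨Finset.univ.erase a, by
    rw [Finset.card_erase_of_mem (Finset.mem_univ a), Finset.card_univ, Fintype.card_fin]⟩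
  have hf : Function.Bijective f := by
    constructor
    · intro a b hab
      have h := congrArg Subtype.val hab
      by_contra hne
      have : a ∈ Finset.univ.erase b := Finset.mem_erase.2 ⟨hne, Finset.mem_univ a⟩
      rw [show Finset.univ.erase b = Finset.univ.erase a from h.symm] at this
      exact Finset.notMem_erase _ _ this
    · rintro ⟨D, hD⟩
      have hcompl : Dᶜ.card = 1 := by
        rw [Finset.card_compl, Fintype.card_fin, hD]
        omega
      obtain ⟨a, ha⟩ := Finset.card_eq_one.1 hcompl
      refine ⟨a, Subtype.ext ?_⟩
      change Finset.univ.erase a = D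
      rw [← compl_compl D, ha, Finset.compl_singleton]
  rw [sum_esymm_eq_prod_sub, ← Matrix.det_submatrix_equiv_self (Equiv.ofBijective f hf)]
  have hdet := Matrix.det_diagonal_sub_vecMulVec _ (fun b => 1 + ZMod.stdAddChar (k b))
    (fun a => 1 + ZMod.stdAddChar (-k a)) hc u
  simp only [one_add_stdAddChar_mul] at hdet
  rw [← hdet]
  congr 1
  ext a b
  rw [Matrix.submatrix_apply, Matrix.sub_apply, Matrix.smul_apply, Matrix.smul_apply,
    symbol_entry_codim_one k _ _ a b rfl rfl, Matrix.one_apply, Matrix.of_apply]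
  simp only [(Equiv.ofBijective f hf).injective.eq_iff, smul_eq_mul]
  split_ifs <;> ring

end Symbols

/-! ### Frequencies, cube counts and assembly. -/

theorem prod_frequencies [∀ i, NeZero (n i)] (f : (∀ i, ZMod (n i)) → ℂ) :
    ∏ k ∈ frequencies n, f (fun i => (k i : ZMod (n i))) = ∏ k, f k := by
  refine Finset.prod_bij (fun k _ i => (k i : ZMod (n i))) (fun _ _ => Finset.mem_univ _) ?_ ?_
    fun _ _ => rfl
  · intro k hk l hl h
    simp only [frequencies, Fintype.mem_piFinset, Finset.mem_Icc] at hk hl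
    funext i
    have h1 := (ZMod.intCast_eq_intCast_iff_dvd_sub (k i : ℤ) (l i) (n i)).1
      (by exact_mod_cast congrFun h i)
    have h2 := Int.eq_zero_of_abs_lt_dvd h1 (by rw [abs_lt]; have := hk i; have := hl i; omega)
    omega
  · intro k _
    -- Frequencies run over 1, …, n_i, so the residue 0 is represented by n_i.
    refine ⟨fun i => if (k i).val = 0 then n i else (k i).val, ?_, ?_⟩
    · simp only [frequencies, Fintype.mem_piFinset, Finset.mem_Icc]
      intro i
      have h1 := (k i).val_lt
      have h2 := NeZero.pos (n i)
      split_ifs <;> omega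
    · funext i
      dsimp only
      split_ifs with h
      · rw [ZMod.natCast_self, (ZMod.val_eq_zero _).1 h]
      · exact ZMod.natCast_zmod_val _

theorem card_cell [∀ i, NeZero (n i)] (d : ℕ) :
    Fintype.card (Cell n d) = q.choose d * ∏ i, n i := by
  rw [← Fintype.card_congr (cellEquiv n d), Fintype.card_prod, Fintype.card_finset_len,
    Fintype.card_fin, Fintype.card_pi]
  simp only [ZMod.card]

theorem card_facet_succ [∀ i, NeZero (n i)] (d : ℕ) :
    Fintype.card (Facet n (d + 1)) = q.choose d * ∏ i, n i := by
  rw [← card_cell]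
  exact Fintype.card_congr (Equiv.subtypeEquivRight fun c => Nat.succ_inj)

theorem card_facet_zero [∀ i, NeZero (n i)] : Fintype.card (Facet n 0) = 0 :=
  Fintype.card_eq_zero_iff.2 ⟨fun c => Nat.succ_ne_zero _ c.2⟩

/-- The zeta function of the `d`-skeleton as a product over the characters of the torus. -/
theorem eventually_zeta_inv_eq [∀ i, NeZero (n i)] (hn : ∀ i, 2 ≤ n i) (d e : ℕ)
    (he : 2 * (q + 1 - d) = e) :
    ∀ᶠ u : ℂ in nhds 0, Multipliable (eulerFactor n d u) ∧ zeta n d u ≠ 0 ∧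
      (zeta n d u)⁻¹ = (1 - u) ^ ((Fintype.card (Cell n d) * (2 * d : ℕ) : ℤ)
          - Fintype.card (Cell n d) - Fintype.card (Facet n d)) *
        (1 + (e - 1) * u) ^ ((Fintype.card (Facet n d) : ℤ) - Fintype.card (Cell n d)) *
        ∏ k, (((1 + ((2 * d : ℕ) - 1) * u) * (1 + (e - 1) * u)) • 1
          - u • (incSymbol n d k * incSymbolTranspose n d k)).det := by
  classical
  have h1 : ∀ᶠ u : ℂ in nhds 0, 1 - u ≠ 0 :=
    (by fun_prop : Continuous fun u : ℂ => 1 - u).continuousAt.eventually_ne (by simp)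
  have h2 : ∀ᶠ u : ℂ in nhds 0, 1 + ((e : ℂ) - 1) * u ≠ 0 :=
    (by fun_prop : Continuous fun u : ℂ => 1 + ((e : ℂ) - 1) * u).continuousAt.eventually_ne
      (by simp)
  filter_upwards [h1, h2, eventually_hasProd_eulerFactor (n := n) d] with u hu1 hu2 ⟨hdet, hprod⟩
  refine ⟨hprod.multipliable, ?_, ?_⟩
  · rw [zeta, hprod.tprod_eq]
    exact inv_ne_zero hdet
  · rw [zeta, hprod.tprod_eq, inv_inv, ← det_smul_one_sub_incMatrix n d hn]
    convert! det_one_sub_smul_stepMatrix (IsFace n d) (d₁ := 2 * d) (d₂ := e) ?_ ?_ u hu1 hu2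
    · exact sum_incMatrix_facet hn
    · intro τ
      rw [← he]
      exact sum_incMatrix_cell hn τ

theorem choose_two_mul_two (q : ℕ) : ((q.choose 2 : ℕ) : ℤ) * 2 = q * (q - 1) := by
  rcases q with _ | q
  · simp
  · rw [Nat.choose_two_right]
    have h := congrArg (Nat.cast : ℕ → ℤ)
      (Nat.div_mul_cancel (Nat.even_mul_pred_self (q + 1)).two_dvd)
    push_cast [Nat.add_sub_cancel] at h ⊢
    linarith

theorem kappa_eq (q : ℕ) : kappa q = q * (2 * (q - 1)) - q - q.choose 2 := by
  refine Int.ediv_eq_of_eq_mul_right two_ne_zero ?_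
  linear_combination choose_two_mul_two q

theorem gamma_eq (q : ℕ) : gamma q = q.choose 2 - q := by
  refine Int.ediv_eq_of_eq_mul_right two_ne_zero ?_
  linear_combination -choose_two_mul_two q

theorem card_facet_top [∀ i, NeZero (n i)] (hq : 1 ≤ q) :
    Fintype.card (Facet n q) = q * ∏ i, n i := by
  obtain ⟨r, rfl⟩ : ∃ r, q = r + 1 := ⟨q - 1, by omega⟩
  rw [card_facet_succ, Nat.choose_succ_self_right]

theorem card_facet_codim_one [∀ i, NeZero (n i)] (hq : 1 ≤ q) :
    Fintype.card (Facet n (q - 1)) = q.choose 2 * ∏ i, n i := by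
  rcases q with _ | _ | r
  · omega
  -- For q = 1 there are no (-1)-cubes, in agreement with `Nat.choose 1 2 = 0`.
  · rw [card_facet_zero]; simp
  · rw [Nat.add_sub_cancel, card_facet_succ, Nat.choose_symm_of_eq_add (a := r) (b := 2) rfl]

theorem card_cell_codim_one [∀ i, NeZero (n i)] (hq : 1 ≤ q) :
    Fintype.card (Cell n (q - 1)) = q * ∏ i, n i := by
  rw [card_cell, Nat.choose_symm hq, Nat.choose_one_right]

theorem eventually_zeta_top [∀ i, NeZero (n i)] (hq : 1 ≤ q) (hn : ∀ i, 2 ≤ n i) :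
    ∀ᶠ u : ℂ in nhds 0, Multipliable (eulerFactor n q u) ∧ zeta n q u ≠ 0 ∧
      (zeta n q u)⁻¹ = (1 - u ^ 2) ^ ((q - 1) * ∏ i, n i) *
        ∏ k ∈ frequencies n,
          (1 - 2 * u * (∑ i, cosAngle n k i) + (2 * (q : ℂ) - 1) * u ^ 2) := by
  -- Each (q-1)-cube lies in two q-cubes, so the second factor is a power of 1 + u; its exponent
  -- equals that of 1 - u and the two merge into 1 - u².
  filter_upwards [eventually_zeta_inv_eq hn q 2 (by omega)] with u ⟨h1, h2, h3⟩
  refine ⟨h1, h2, ?_⟩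
  have he1 : ((Fintype.card (Cell n q) * (2 * q : ℕ) : ℤ)
      - Fintype.card (Cell n q) - Fintype.card (Facet n q)) = ((q - 1) * ∏ i, n i : ℕ) := by
    rw [card_cell, card_facet_top hq, Nat.choose_self]
    push_cast [hq]
    ring
  have he2 : ((Fintype.card (Facet n q) : ℤ) - Fintype.card (Cell n q))
      = ((q - 1) * ∏ i, n i : ℕ) := by
    rw [card_cell, card_facet_top hq, Nat.choose_self]
    push_cast [hq]
    ring
  rw [h3, he1, he2, zpow_natCast, zpow_natCast, ← mul_pow]
  congr 1
  · congr 1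
    push_cast
    ring
  · simp only [cosAngle_eq_torusCos]
    rw [prod_frequencies fun k => 1 - 2 * u * (∑ i, torusCos k i) + (2 * (q : ℂ) - 1) * u ^ 2]
    refine Finset.prod_congr rfl fun k _ => ?_
    rw [det_symbol_top, Finset.sum_add_distrib, ← Finset.mul_sum, Finset.sum_const,
      Finset.card_univ, Fintype.card_fin, nsmul_eq_mul]
    push_cast
    ring

theorem eventually_zeta_codim_one [∀ i, NeZero (n i)] (hq : 1 ≤ q) (hn : ∀ i, 2 ≤ n i) :
    ∀ᶠ u : ℂ in nhds 0, Multipliable (eulerFactor n (q - 1) u) ∧ zeta n (q - 1) u ≠ 0 ∧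
      (zeta n (q - 1) u)⁻¹ = (1 - u) ^ (kappa q * ∏ i, (n i : ℤ)) *
        (1 + 3 * u) ^ (gamma q * ∏ i, (n i : ℤ)) * ∏ k ∈ frequencies n, FUp n u k := by
  have hne : ∀ᶠ u : ℂ in nhds 0, ∀ k : ∀ i, ZMod (n i), ∀ a,
      (1 + ((2 * (q - 1) : ℕ) - 1) * u) * (1 + ((4 : ℕ) - 1) * u)
        - u * ∑ i, (2 + 2 * torusCos k i) + 2 * u * (2 + 2 * torusCos k a) ≠ 0 := by
    -- There are finitely many conditions, each on a continuous function with value 1 at u = 0; they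
    -- make the diagonal part of every block invertible.
    refine Filter.eventually_all.2 fun k => Filter.eventually_all.2 fun a => ?_
    have hcont : Continuous fun u : ℂ =>
        (1 + ((2 * (q - 1) : ℕ) - 1) * u) * (1 + ((4 : ℕ) - 1) * u)
        - u * ∑ i, (2 + 2 * torusCos k i) + 2 * u * (2 + 2 * torusCos k a) := by fun_prop
    exact hcont.continuousAt.eventually_ne (by simp)
  -- A (q-2)-cube lies in four (q-1)-cubes, whence the factor 1 + 3u.
  filter_upwards [eventually_zeta_inv_eq hn (q - 1) 4 (by omega), hne] with u ⟨h1, h2, h3⟩ hu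
  refine ⟨h1, h2, ?_⟩
  have he1 : ((Fintype.card (Cell n (q - 1)) * (2 * (q - 1) : ℕ) : ℤ)
      - Fintype.card (Cell n (q - 1)) - Fintype.card (Facet n (q - 1)))
      = kappa q * ∏ i, (n i : ℤ) := by
    rw [card_cell_codim_one hq, card_facet_codim_one hq, kappa_eq]
    push_cast [hq]
    ring
  have he2 : ((Fintype.card (Facet n (q - 1)) : ℤ) - Fintype.card (Cell n (q - 1)))
      = gamma q * ∏ i, (n i : ℤ) := by
    rw [card_cell_codim_one hq, card_facet_codim_one hq, gamma_eq]
    push_cast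
    ring
  rw [h3, he1, he2]
  congr 1
  · congr 3
    push_cast
    ring
  · simp only [FUp, cosAngle_eq_torusCos]
    rw [prod_frequencies fun k => ∑ l ∈ Finset.range (q + 1),
      (2 - (l : ℂ)) * (2 : ℂ) ^ ((l : ℤ) - 1) *
      MvPolynomial.eval (fun i => 2 + 2 * torusCos k i) (MvPolynomial.esymm (Fin q) ℂ l) *
      (1 - 2 * u * (∑ i, torusCos k i) + 3 * (2 * (q : ℂ) - 3) * u ^ 2) ^ (q - l) * u ^ l]
    refine Finset.prod_congr rfl fun k _ => ?_
    rw [det_symbol_codim_one hq k _ u (hu k)]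
    have hX : (1 + ((2 * (q - 1) : ℕ) - 1) * u) * (1 + ((4 : ℕ) - 1) * u)
        - u * ∑ i, (2 + 2 * torusCos k i)
        = 1 - 2 * u * (∑ i, torusCos k i) + 3 * (2 * (q : ℂ) - 3) * u ^ 2 := by
      rw [Finset.sum_add_distrib, ← Finset.mul_sum, Finset.sum_const, Finset.card_univ,
        Fintype.card_fin, nsmul_eq_mul]
      push_cast [hq]
      ring
    rw [hX]

end PeriodicCubical

theorem theorem1p2 (q : ℕ) (hq : 1 ≤ q) (n : Fin q → ℕ) (hn : ∀ i, 2 ≤ n i) :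
    ∃ ε : ℝ, 0 < ε ∧ ∀ u : ℂ, ‖u‖ < ε →
      (Multipliable (PeriodicCubical.eulerFactor n q u) ∧
        PeriodicCubical.zeta n q u ≠ 0 ∧
        (PeriodicCubical.zeta n q u)⁻¹ =
          (1 - u ^ 2) ^ ((q - 1) * ∏ i, n i) *
            ∏ k ∈ PeriodicCubical.frequencies n,
              (1 - 2 * u * (∑ i, PeriodicCubical.cosAngle n k i) + (2 * (q : ℂ) - 1) * u ^ 2)) ∧
      (Multipliable (PeriodicCubical.eulerFactor n (q - 1) u) ∧
        PeriodicCubical.zeta n (q - 1) u ≠ 0 ∧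
        (PeriodicCubical.zeta n (q - 1) u)⁻¹ =
          (1 - u) ^ (PeriodicCubical.kappa q * ∏ i, (n i : ℤ)) *
            (1 + 3 * u) ^ (PeriodicCubical.gamma q * ∏ i, (n i : ℤ)) *
            ∏ k ∈ PeriodicCubical.frequencies n, PeriodicCubical.FUp n u k) := by
  have hne : ∀ i, NeZero (n i) := fun i => ⟨by have := hn i; omega⟩
  obtain ⟨ε, hε, h⟩ := Metric.eventually_nhds_iff.1
    ((PeriodicCubical.eventually_zeta_top hq hn).and
      (PeriodicCubical.eventually_zeta_codim_one hq hn))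
  exact ⟨ε, hε, fun u hu => h (by rwa [dist_zero_right])⟩
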